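/- **Concentration at branch points.** Let $\alpha_0,\dots,\alpha_{2m-1}\in(0,\pi)$ with $\sum_j\alpha_j=2\pi$ and $l_0,\dots,l_{2m-1}>0$ (indices are read modulo $2m$). Put $\beta_j=\sum_{k<j}\alpha_k$, $\mathbf s_j=(\cos\beta_j,\sin\beta_j)\in\mathbb R^2$, and let $T=\bigcup_j S_j$ be the closed $m$-star with sectors $S_j=\{c\,\mathbf s_j+d\,\mathbf s_{j+1}: 0\le c\le l_j,\ 0\le d\le l_{j+1}\}$. On $S_j$ use the asymptotic coordinates $(u,v)=(c,d)$ if $j$ is even and $(u,v)=(d,c)$ if $j$ is odd, so that even rays are $u$-curves and odd rays are $v$-curves. Let $r:T\to\mathbb R^3$ and $N:T\to S^2$ be continuous maps such that 1. on each closed sector, in its coordinates $(u,v)$, $r$ is an immersed $C^{1M}$ pseudospherical front with normal $N$. That is: $r$ and $N$ are $C^1$ with continuous mixed derivatives $\partial_u\partial_v=\partial_v\partial_u$; $N_u,N_v\neq0$; $N_{uv}=\nu N$ for a continuous function $\nu$; $r_u=N_u\times N$ and $r_v=-N_v\times N$; and $r_u,r_v$ are linearly independent (derivatives are one-sided on the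 boundary of the sector); 2. for some orthonormal $\mathbf e_1,\mathbf e_2$ with $\mathbf e_1\times\mathbf e_2=N(0)$, the curve $t\mapsto r(t\,\mathbf s_j)$ leaves $p=r(0)$ in the direction $\cos\beta_j\,\mathbf e_1+\sin\beta_j\,\mathbf e_2$, for every $j$. On each sector let $\sigma=\operatorname{sign}\langle r_u\times r_v,N\rangle$, and let $\varphi\in(0,\pi)$ be the asymptotic angle, $\cos\varphi=\sigma\,\langle r_u,r_v\rangle/(|r_u||r_v|)$. For a polygon bounded by asymptotic arcs and traversed counterclockwise, let $\Delta$ be the sum of the values of $\varphi$ at its vertices, with sign $+$ at initial vertices of $u$-arcs and $-$ at terminal vertices of $u$-arcs. In particular, for the boundary of $T$, whose vertices are the outer corners $q_j=l_j\mathbf s_j+l_{j+1}\mathbf s_{j+1}$, $\Delta_T=\sum_{j=0}^{2m-1}(-1)^j\varphi(q_j)$. Let $A(T)=\sum_j\iint_{S_j}|r_u\times r_v|\,du\,dv$ be the area of the immersed star. Then $$\Delta_T=A(T)-(m-2)\pi .$$ Moreover, $\Delta$ does not concentrate along the asymptotic curves that meet at $p$: there is a constant $C$, depending only on $T$, $r$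 and $N$, such that for every $j$, all $0\le t_0\le t_1\le l_{j+1}$ and all $0<\varepsilon\le\min(l_j,l_{j+2})$, the thin rectangle $R_\varepsilon$ that straddles the ray $j+1$ between the distances $t_0$ and $t_1$ along it, with vertices $t_i\mathbf s_{j+1}+\varepsilon\mathbf s_j$ and $t_i\mathbf s_{j+1}+\varepsilon\mathbf s_{j+2}$ ($i=0,1$), satisfies $|\Delta_{R_\varepsilon}|\le C\varepsilon$. (If $t_0=0$, the value of $\varphi$ at a vertex lying on another ray is the one taken from the sector $S_j$, respectively $S_{j+1}$, that contains this side of $R_\varepsilon$.) -/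

import Mathlib

noncomputable section

namespace PSBranch

open Set

abbrev Plane : Type := EuclideanSpace ℝ (Fin 2)

abbrev Space : Type := EuclideanSpace ℝ (Fin 3)

/-- The cross product of Euclidean three-space. -/
def cross (x y : Space) : Space := WithLp.toLp 2 (crossProduct x.ofLp y.ofLp)

/-! Maps of the two asymptotic coordinates on a closed rectangle `[0,a] × [0,b]`.
All derivatives are taken within the rectangle, hence one-sided on its boundary. -/

/-- `∂f/∂u` on a rectangle of side `a` in the `u`-direction. -/
def partialU (a : ℝ) (f : ℝ → ℝ → Space) (u v : ℝ) : Space :=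
  derivWithin (fun x => f x v) (Icc 0 a) u

/-- `∂f/∂v` on a rectangle of side `b` in the `v`-direction. -/
def partialV (b : ℝ) (f : ℝ → ℝ → Space) (u v : ℝ) : Space :=
  derivWithin (fun y => f u y) (Icc 0 b) v

/-- `f` is `C^{1M}` on `[0,a] × [0,b]`: its first partial derivatives exist and are continuous, and
its mixed partial derivatives exist, are continuous and coincide. -/
structure IsC1M (a b : ℝ) (f : ℝ → ℝ → Space) : Prop where
  diff_u : ∀ u ∈ Icc 0 a, ∀ v ∈ Icc 0 b,
    DifferentiableWithinAt ℝ (fun x => f x v) (Icc 0 a) u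
  diff_v : ∀ u ∈ Icc 0 a, ∀ v ∈ Icc 0 b,
    DifferentiableWithinAt ℝ (fun y => f u y) (Icc 0 b) v
  cont_u : ContinuousOn (fun p : ℝ × ℝ => partialU a f p.1 p.2) (Icc 0 a ×ˢ Icc 0 b)
  cont_v : ContinuousOn (fun p : ℝ × ℝ => partialV b f p.1 p.2) (Icc 0 a ×ˢ Icc 0 b)
  diff_uv : ∀ u ∈ Icc 0 a, ∀ v ∈ Icc 0 b,
    DifferentiableWithinAt ℝ (fun y => partialU a f u y) (Icc 0 b) v
  diff_vu : ∀ u ∈ Icc 0 a, ∀ v ∈ Icc 0 b,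
    DifferentiableWithinAt ℝ (fun x => partialV b f x v) (Icc 0 a) u
  cont_uv : ContinuousOn (fun p : ℝ × ℝ => partialV b (partialU a f) p.1 p.2)
    (Icc 0 a ×ˢ Icc 0 b)
  mixed_eq : ∀ u ∈ Icc 0 a, ∀ v ∈ Icc 0 b,
    partialV b (partialU a f) u v = partialU a (partialV b f) u v

/-- `N : [0,a] × [0,b] → S²` is weakly Lorentz harmonic. -/
structure IsWeaklyHarmonic (a b : ℝ) (N : ℝ → ℝ → Space) : Prop where
  c1m : IsC1M a b N
  unit : ∀ u ∈ Icc 0 a, ∀ v ∈ Icc 0 b, ‖N u v‖ = 1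
  regular_u : ∀ u ∈ Icc 0 a, ∀ v ∈ Icc 0 b, partialU a N u v ≠ 0
  regular_v : ∀ u ∈ Icc 0 a, ∀ v ∈ Icc 0 b, partialV b N u v ≠ 0
  moutard : ∃ ν : ℝ → ℝ → ℝ,
    ContinuousOn (fun p : ℝ × ℝ => ν p.1 p.2) (Icc 0 a ×ˢ Icc 0 b) ∧
    ∀ u ∈ Icc 0 a, ∀ v ∈ Icc 0 b, partialV b (partialU a N) u v = ν u v • N u v

/-- `r : [0,a] × [0,b] → ℝ³` is a `C^{1M}` pseudospherical front with normal field `N`: the normal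
is weakly harmonic and `r` is a weakly regular `C^{1M}` solution of the Lelieuvre equations
`r_u = N_u × N`, `r_v = - N_v × N`. -/
structure IsPSFront (a b : ℝ) (r N : ℝ → ℝ → Space) : Prop where
  harmonic : IsWeaklyHarmonic a b N
  c1m : IsC1M a b r
  lelieuvre_u : ∀ u ∈ Icc 0 a, ∀ v ∈ Icc 0 b,
    partialU a r u v = cross (partialU a N u v) (N u v)
  lelieuvre_v : ∀ u ∈ Icc 0 a, ∀ v ∈ Icc 0 b,
    partialV b r u v = -cross (partialV b N u v) (N u v)
  regular_u : ∀ u ∈ Icc 0 a, ∀ v ∈ Icc 0 b, partialU a r u v ≠ 0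
  regular_v : ∀ u ∈ Icc 0 a, ∀ v ∈ Icc 0 b, partialV b r u v ≠ 0

/-- `σ`, the sign of the frame `(r_u, r_v)` in the orientation of the surface given by `N`. -/
def orientationSign (a b : ℝ) (r N : ℝ → ℝ → Space) (u v : ℝ) : ℝ :=
  Real.sign (inner ℝ (cross (partialU a r u v) (partialV b r u v)) (N u v))

/-- The asymptotic angle `φ ∈ [0,π]`, with `cos φ = σ ⟨r_u, r_v⟩ / (|r_u| |r_v|)`. -/
def asymptoticAngle (a b : ℝ) (r N : ℝ → ℝ → Space) (u v : ℝ) : ℝ :=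
  Real.arccos (orientationSign a b r N u v *
    (inner ℝ (partialU a r u v) (partialV b r u v) /
      (‖partialU a r u v‖ * ‖partialV b r u v‖)))

/-- The area of the immersed quadrilateral `r : [0,a] × [0,b] → ℝ³`. -/
def quadArea (a b : ℝ) (r : ℝ → ℝ → Space) : ℝ :=
  ∫ u in (0 : ℝ)..a, ∫ v in (0 : ℝ)..b, ‖cross (partialU a r u v) (partialV b r u v)‖

/-- The data of an `m`-star: `2m` angles in `(0,π)` with sum `2π`, and `2m` lengths. Indices are
natural numbers read modulo `2m`; `angle j` is the angle between the rays `j` and `j+1`, and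
`len j` is the length of the ray `j`. The conditions force `m ≥ 2`. -/
structure MStar (m : ℕ) where
  angle : ℕ → ℝ
  len : ℕ → ℝ
  angle_periodic : Function.Periodic angle (2 * m)
  len_periodic : Function.Periodic len (2 * m)
  angle_pos : ∀ j, 0 < angle j
  angle_lt : ∀ j, angle j < Real.pi
  angle_sum : ∑ j ∈ Finset.range (2 * m), angle j = 2 * Real.pi
  len_pos : ∀ j, 0 < len j

namespace MStar

variable {m : ℕ}

/-- The polar angle `β_j` of the ray `j`. -/
def polar (T : MStar m) (j : ℕ) : ℝ := ∑ k ∈ Finset.range j, T.angle k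

/-- The unit vector `s_j` that spans the ray `j`. -/
def ray (T : MStar m) (j : ℕ) : Plane := !₂[Real.cos (T.polar j), Real.sin (T.polar j)]

/-- Even rays are `u`-curves and odd rays are `v`-curves. The sector `j` lies between the rays `j`
and `j+1`; this is the one of the two that is a `u`-curve. -/
def uRay (j : ℕ) : ℕ := if Even j then j else j + 1

/-- The one of the two rays that bound the sector `j` that is a `v`-curve. -/
def vRay (j : ℕ) : ℕ := if Even j then j + 1 else j

/-- The side lengths of the sector `j` in the two asymptotic coordinates. -/
def uLen (T : MStar m) (j : ℕ) : ℝ := T.len (uRay j)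

def vLen (T : MStar m) (j : ℕ) : ℝ := T.len (vRay j)

/-- The point of the sector `j` with asymptotic coordinates `(u,v)`, both measured from the centre
of the star. -/
def chart (T : MStar m) (j : ℕ) (u v : ℝ) : Plane :=
  u • T.ray (uRay j) + v • T.ray (vRay j)

/-- The closed sector `j`. -/
def sector (T : MStar m) (j : ℕ) : Set Plane :=
  (fun p : ℝ × ℝ => T.chart j p.1 p.2) '' (Icc 0 (T.uLen j) ×ˢ Icc 0 (T.vLen j))

/-- The closed `m`-star, as a subset of the plane. -/
def carrier (T : MStar m) : Set Plane := ⋃ j, T.sector j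

/-- A map on the star, in the asymptotic coordinates of the sector `j`. -/
def pull (T : MStar m) (f : Plane → Space) (j : ℕ) (u v : ℝ) : Space := f (T.chart j u v)

/-- The tangent vector at the centre of the image of the ray `j`, directed away from the centre. -/
def outgoing (T : MStar m) (r : Plane → Space) (j : ℕ) : Space :=
  derivWithin (fun t : ℝ => r (t • T.ray j)) (Icc 0 (T.len j)) 0

/-- `r`, with normal field `N`, realizes `T` as a star of `2m` immersed asymptotic quadrilaterals
around the point `p = r 0` of a pseudospherical surface. Both maps are continuous on the star, so
neighbouring quadrilaterals share their edge and the normal along it. The last field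
says that the angles of the star are the angles between the asymptotic curves at `p`: after an
identification of the plane with the tangent plane at `p`, which is oriented by `N`, the
curve `j` leaves `p` in the direction of the ray `j`. -/
structure IsBranchedFront (T : MStar m) (r N : Plane → Space) : Prop where
  continuousOn : ContinuousOn r T.carrier
  continuousOn_normal : ContinuousOn N T.carrier
  psFront : ∀ j, IsPSFront (T.uLen j) (T.vLen j) (T.pull r j) (T.pull N j)
  immersed : ∀ j, ∀ u ∈ Icc 0 (T.uLen j), ∀ v ∈ Icc 0 (T.vLen j),
    LinearIndependent ℝ
      ![partialU (T.uLen j) (T.pull r j) u v, partialV (T.vLen j) (T.pull r j) u v]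
  tangent : ∃ e₁ e₂ : Space, Orthonormal ℝ ![e₁, e₂] ∧ cross e₁ e₂ = N 0 ∧
    ∀ j, ∃ c : ℝ, 0 < c ∧
      T.outgoing r j = c • (Real.cos (T.polar j) • e₁ + Real.sin (T.polar j) • e₂)

/-- The asymptotic angle `φ` on the sector `j`, in its asymptotic coordinates. -/
def phi (T : MStar m) (r N : Plane → Space) (j : ℕ) (u v : ℝ) : ℝ :=
  asymptoticAngle (T.uLen j) (T.vLen j) (T.pull r j) (T.pull N j) u v

/-- `φ` at the point `c • s_j + d • s_{j+1}` of the sector `j`. -/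
def phiRay (T : MStar m) (r N : Plane → Space) (j : ℕ) (c d : ℝ) : ℝ :=
  if Even j then T.phi r N j c d else T.phi r N j d c

/-- The alternating vertex sum of `φ` over the boundary polygon of the star. Its vertices are the
outer corners `q_j` of the sectors. In the counterclockwise sense, the arc that leaves `q_j` crosses
the end of the ray `j+1`; it is a `u`-curve if and only if that ray is a `v`-curve, that is, if and
only if `j` is even. Initial vertices of `u`-arcs count `+1`, terminal vertices count `-1`. -/
def vertexSum (T : MStar m) (r N : Plane → Space) : ℝ :=
  ∑ j ∈ Finset.range (2 * m), (-1 : ℝ) ^ j * T.phi r N j (T.uLen j) (T.vLen j)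

/-- The area of the immersed star. -/
def area (T : MStar m) (r : Plane → Space) : ℝ :=
  ∑ j ∈ Finset.range (2 * m), quadArea (T.uLen j) (T.vLen j) (T.pull r j)

/-- The alternating vertex sum of `φ` over the boundary polygon of the thin rectangle that straddles
the ray `j+1`: it runs from distance `t₀` to distance `t₁` along the ray, and extends by `ε` into
the sectors `j` and `j+1` on its two sides. In counterclockwise order, its vertices are `q⁻`, `r⁻`
in the sector `j` and `r⁺`, `q⁺` in the sector `j+1`, where `q` stands for `t₀` and `r` for `t₁`.
The arc from `q⁻` to `r⁻` is a `u`-curve if and only if `j+1` is even. -/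
def stripSum (T : MStar m) (r N : Plane → Space) (j : ℕ) (t₀ t₁ ε : ℝ) : ℝ :=
  (-1 : ℝ) ^ (j + 1) *
    (T.phiRay r N j ε t₀ - T.phiRay r N j ε t₁
      + T.phiRay r N (j + 1) t₁ ε - T.phiRay r N (j + 1) t₀ ε)

end MStar

end PSBranch

end

/-! Identify each tangent plane of the sphere with `ℂ`, so that `pairing n X Y` is the conjugate of
`X` times `Y`. The equation `N_uv = ν N` says that `N_u` is parallel along the `v`-curves of the
spherical map `N` and `N_v` along its `u`-curves. Hence `|N_u|` depends on `u` alone and `|N_v|` on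
`v` alone. By the Lelieuvre equations, `φ` is, up to the sign `-σ`, the phase of the pairing of
`N_u` with `N_v`.

On a rectangle, the double difference of `φ` over the corners is therefore a holonomy of the unit
sphere: modulo `2π` it is minus the integral of the Jacobian of `N`. For small rectangles both sides
are small and the congruence is an equality; additivity carries it to all rectangles
(`SphericalNet.hazzidakis`). Only `N`, `N_u`, `N_v`, `N_uv` enter, which is why `C^{1M}` regularity
suffices. For an immersed front `|r_u × r_v| = -σ J`, with `J` the Jacobian, so the double
difference over a sector is `σ` times its area. The tangent condition at `p` forces `σ = (-1)^j` on
the sector `j` (`sector_defect`).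

Two neighbouring sectors share `N` along their common ray, and their transversal derivatives of `N`
are both parallel along it. The angle between these two fields is constant, so the jump of `φ`
across a ray equals its jump at `p` (`phiRay_sub_eq`). When the sector formulas are added with
alternating signs, the values at the ends of the rays telescope. What remains is the area plus the
alternating sum of `φ` at `p`. There `φ` is `α_j` for even `j` and `π - α_j` for odd `j`, so that
sum is `2π - mπ`.

In a thin strip the constant jump across the ray cancels between its two ends. What is left is two
double differences, each bounded by a multiple of the area of a half-strip in the coordinates. -/

noncomputable section

namespace PSBranch

open Set

/-! ### Vector algebra -/

/-- The complex number `⟨X,Y⟩ + i ⟨n, X × Y⟩`; in the plane orthogonal to the unit vector `n`, it is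
the product of `Y` with the conjugate of `X`. -/
def pairing (n X Y : Space) : ℂ := ⟨inner ℝ X Y, inner ℝ n (cross X Y)⟩

lemma inner_coord (x y : Space) : inner ℝ x y = x 0 * y 0 + x 1 * y 1 + x 2 * y 2 := by
  simp [PiLp.inner_apply, Fin.sum_univ_three, mul_comm]

lemma cross_zero (x y : Space) : cross x y 0 = x 1 * y 2 - x 2 * y 1 := by
  simp [cross, cross_apply]

lemma cross_one (x y : Space) : cross x y 1 = x 2 * y 0 - x 0 * y 2 := by
  simp [cross, cross_apply]

lemma cross_two (x y : Space) : cross x y 2 = x 0 * y 1 - x 1 * y 0 := by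
  simp [cross, cross_apply]

lemma normSq_coord (x : Space) : ‖x‖ ^ 2 = x 0 * x 0 + x 1 * x 1 + x 2 * x 2 := by
  rw [← real_inner_self_eq_norm_sq, inner_coord]

lemma inner_cross_cross {n : Space} (hn : ‖n‖ = 1) {X Y : Space} (hX : inner ℝ n X = 0) :
    inner ℝ (cross X n) (cross Y n) = inner ℝ X Y := by
  have h := normSq_coord n
  rw [hn] at h
  simp only [inner_coord, cross_zero, cross_one, cross_two] at *
  linear_combination (-(X 0 * Y 0 + X 1 * Y 1 + X 2 * Y 2)) * h -
    (n 0 * Y 0 + n 1 * Y 1 + n 2 * Y 2) * hX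

lemma norm_cross_of_orthogonal {n : Space} (hn : ‖n‖ = 1) {X : Space} (hX : inner ℝ n X = 0) :
    ‖cross X n‖ = ‖X‖ := by
  have h := inner_cross_cross hn hX (Y := X)
  rw [real_inner_self_eq_norm_sq, real_inner_self_eq_norm_sq] at h
  exact (sq_eq_sq₀ (norm_nonneg _) (norm_nonneg _)).1 h

lemma cross_cross_cross (n X Y : Space) :
    cross (cross X n) (-cross Y n) = (-inner ℝ n (cross X Y)) • n := by
  ext i
  fin_cases i <;>
    simp only [cross_zero, cross_one, cross_two, inner_coord, PiLp.neg_apply, PiLp.smul_apply,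
      smul_eq_mul, Fin.zero_eta, Fin.mk_one, Fin.reduceFinMk] <;> ring

/-- The square of `det (n,X,Y)` is the Gram determinant of the three vectors, which reduces to that
of `X`, `Y` because `n` is a unit vector orthogonal to both. The coefficients below come from
expanding this determinant. -/
lemma pairing_normSq {n : Space} (hn : ‖n‖ = 1) {X Y : Space} (hX : inner ℝ n X = 0)
    (hY : inner ℝ n Y = 0) :
    (inner ℝ X Y) ^ 2 + (inner ℝ n (cross X Y)) ^ 2 = (‖X‖ * ‖Y‖) ^ 2 := by
  have h := normSq_coord n
  rw [mul_pow, normSq_coord, normSq_coord]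
  rw [hn] at h
  simp only [inner_coord, cross_zero, cross_one, cross_two] at *
  linear_combination
    (-((X 0 * X 0 + X 1 * X 1 + X 2 * X 2) * (Y 0 * Y 0 + Y 1 * Y 1 + Y 2 * Y 2) -
      (X 0 * Y 0 + X 1 * Y 1 + X 2 * Y 2) ^ 2)) * h -
    ((n 0 * X 0 + n 1 * X 1 + n 2 * X 2) * (Y 0 * Y 0 + Y 1 * Y 1 + Y 2 * Y 2) -
      (X 0 * Y 0 + X 1 * Y 1 + X 2 * Y 2) * (n 0 * Y 0 + n 1 * Y 1 + n 2 * Y 2)) * hX +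
    ((n 0 * X 0 + n 1 * X 1 + n 2 * X 2) * (X 0 * Y 0 + X 1 * Y 1 + X 2 * Y 2) -
      (X 0 * X 0 + X 1 * X 1 + X 2 * X 2) * (n 0 * Y 0 + n 1 * Y 1 + n 2 * Y 2)) * hY

lemma conj_pairing (n X Y : Space) : (starRingEnd ℂ) (pairing n X Y) = pairing n Y X := by
  apply Complex.ext
  · simp [pairing, real_inner_comm]
  · simp only [pairing, Complex.conj_im, inner_coord, cross_zero, cross_one, cross_two]; ring

/-- In complex notation, `(Z̄ X)(X̄ Y) = |X|² Z̄ Y`. The vector `Z` need not be tangent, since its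
normal component contributes to neither pairing. This eliminates the tangent vector shared by two
adjacent nets. -/
lemma pairing_mul_pairing {n : Space} (hn : ‖n‖ = 1) {X Y Z : Space} (hX : inner ℝ n X = 0)
    (hY : inner ℝ n Y = 0) :
    pairing n Z X * pairing n X Y = (‖X‖ ^ 2 : ℝ) * pairing n Z Y := by
  have h := normSq_coord n
  rw [normSq_coord]
  rw [hn] at h
  apply Complex.ext <;>
  simp only [pairing, Complex.mul_re, Complex.mul_im, Complex.ofReal_re, Complex.ofReal_im,
    inner_coord, cross_zero, cross_one, cross_two] at *
  · linear_combination
      (-((X 0 * X 0 + X 1 * X 1 + X 2 * X 2) * (Z 0 * Y 0 + Z 1 * Y 1 + Z 2 * Y 2) -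
        (X 0 * Y 0 + X 1 * Y 1 + X 2 * Y 2) * (X 0 * Z 0 + X 1 * Z 1 + X 2 * Z 2))) * h -
      ((n 0 * X 0 + n 1 * X 1 + n 2 * X 2) * (Z 0 * Y 0 + Z 1 * Y 1 + Z 2 * Y 2) -
        (X 0 * Y 0 + X 1 * Y 1 + X 2 * Y 2) * (n 0 * Z 0 + n 1 * Z 1 + n 2 * Z 2)) * hX +
      ((n 0 * X 0 + n 1 * X 1 + n 2 * X 2) * (X 0 * Z 0 + X 1 * Z 1 + X 2 * Z 2) -
        (n 0 * Z 0 + n 1 * Z 1 + n 2 * Z 2) * (X 0 * X 0 + X 1 * X 1 + X 2 * X 2)) * hY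
  · linear_combination (X 0 * (Z 1 * Y 2 - Z 2 * Y 1) + X 1 * (Z 2 * Y 0 - Z 0 * Y 2) +
      X 2 * (Z 0 * Y 1 - Z 1 * Y 0)) * (-hX)

/-! ### Calculus -/

/-- Integrating factor: `z` times `exp (-i ∫ k)` has derivative zero. -/
lemma linear_ode {a b : ℝ} (hab : a ≤ b) {z : ℝ → ℂ} {k : ℝ → ℝ} (hk : ContinuousOn k (Icc a b))
    (hz : ∀ t ∈ Icc a b, HasDerivWithinAt z (Complex.I * k t * z t) (Icc a b) t) :
    z b = z a * Complex.exp (Complex.I * (∫ t in a..b, k t : ℝ)) := by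
  have hK : ∀ t ∈ Icc a b, HasDerivWithinAt (fun t => ∫ x in a..t, k x) (k t) (Icc a b) t := by
    intro t ht
    have : Fact (t ∈ Icc a b) := ⟨ht⟩
    refine intervalIntegral.integral_hasDerivWithinAt_right ?_ (s := Icc a b) (t := Icc a b) ?_ ?_
    · refine (hk.mono ?_).intervalIntegrable
      rw [uIcc_of_le ht.1]; exact Icc_subset_Icc_right ht.2
    · exact hk.stronglyMeasurableAtFilter_nhdsWithin measurableSet_Icc t
    · exact hk t ht
  have hg : ∀ t ∈ Icc a b, HasDerivWithinAt
      (fun t => z t * Complex.exp (-Complex.I * (∫ x in a..t, k x : ℝ))) 0 (Icc a b) t := by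
    intro t ht
    have h := (hz t ht).mul ((((hK t ht).ofReal_comp).const_mul (-Complex.I)).cexp)
    refine h.congr_deriv ?_
    ring
  have hc := constant_of_has_deriv_right_zero (fun t ht => (hg t ht).continuousWithinAt)
    (fun t ht => ((hg t (Ico_subset_Icc_self ht)).mono_of_mem_nhdsWithin
      (Icc_mem_nhdsGE_of_mem ht))) b (right_mem_Icc.2 hab)
  simp only [intervalIntegral.integral_same, Complex.ofReal_zero, mul_zero, Complex.exp_zero,
    mul_one] at hc
  rw [← hc, mul_assoc, ← Complex.exp_add]
  simp

lemma integral_of_hasDerivWithinAt_Icc {a b : ℝ} (hab : a ≤ b) {f f' : ℝ → ℝ}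
    (hf : ∀ t ∈ Icc a b, HasDerivWithinAt f (f' t) (Icc a b) t) (hc : ContinuousOn f' (Icc a b)) :
    ∫ t in a..b, f' t = f b - f a := by
  refine intervalIntegral.integral_eq_sub_of_hasDeriv_right_of_le hab
    (fun t ht => (hf t ht).continuousWithinAt) (fun t ht => ?_) ?_
  · exact ((hf t (Ioo_subset_Icc_self ht)).hasDerivAt (Icc_mem_nhds ht.1 ht.2)).hasDerivWithinAt
  · exact ContinuousOn.intervalIntegrable (by rwa [uIcc_of_le hab])

lemma continuousOn_slice_left {X : Type*} [TopologicalSpace X] {s t : Set ℝ} {f : ℝ → ℝ → X}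
    (hf : ContinuousOn (fun p : ℝ × ℝ => f p.1 p.2) (s ×ˢ t)) {v : ℝ} (hv : v ∈ t) :
    ContinuousOn (fun u => f u v) s :=
  hf.comp (f := fun u => (u, v)) (by fun_prop) (fun _ hu => ⟨hu, hv⟩)

lemma continuousOn_slice_right {X : Type*} [TopologicalSpace X] {s t : Set ℝ} {f : ℝ → ℝ → X}
    (hf : ContinuousOn (fun p : ℝ × ℝ => f p.1 p.2) (s ×ˢ t)) {u : ℝ} (hu : u ∈ s) :
    ContinuousOn (fun v => f u v) t :=
  hf.comp (f := fun v => (u, v)) (by fun_prop) (fun _ hv => ⟨hu, hv⟩)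

/-- Clamping both coordinates to the rectangle makes the integrand continuous on the whole plane, as
the results on parametric integrals require. -/
lemma exists_continuous_extension {a b c d : ℝ} (hab : a ≤ b) (hcd : c ≤ d) {f : ℝ → ℝ → ℝ}
    (hf : ContinuousOn (fun p : ℝ × ℝ => f p.1 p.2) (Icc a b ×ˢ Icc c d)) :
    ∃ g : ℝ → ℝ → ℝ, Continuous (Function.uncurry g) ∧
      ∀ u ∈ Icc a b, ∀ v ∈ Icc c d, g u v = f u v := by
  refine ⟨fun u v => f (projIcc a b hab u) (projIcc c d hcd v), ?_, fun u hu v hv => ?_⟩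
  · exact hf.comp_continuous
      (f := fun p : ℝ × ℝ => ((projIcc a b hab p.1 : ℝ), (projIcc c d hcd p.2 : ℝ))) (by fun_prop)
      (fun p => ⟨(projIcc a b hab p.1).2, (projIcc c d hcd p.2).2⟩)
  · simp [projIcc_of_mem hab hu, projIcc_of_mem hcd hv]

lemma integral_integral_congr {a b c d : ℝ} (hab : a ≤ b) (hcd : c ≤ d) {f g : ℝ → ℝ → ℝ}
    (h : ∀ u ∈ Icc a b, ∀ v ∈ Icc c d, f u v = g u v) :
    ∫ u in a..b, ∫ v in c..d, f u v = ∫ u in a..b, ∫ v in c..d, g u v := by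
  refine intervalIntegral.integral_congr fun u hu => intervalIntegral.integral_congr fun v hv => ?_
  rw [uIcc_of_le hab] at hu
  rw [uIcc_of_le hcd] at hv
  exact h u hu v hv

lemma continuousOn_integral_right {a b c d : ℝ} (hab : a ≤ b) (hcd : c ≤ d) {f : ℝ → ℝ → ℝ}
    (hf : ContinuousOn (fun p : ℝ × ℝ => f p.1 p.2) (Icc a b ×ˢ Icc c d)) :
    ContinuousOn (fun u => ∫ v in c..d, f u v) (Icc a b) := by
  obtain ⟨g, hg, hgf⟩ := exists_continuous_extension hab hcd hf
  refine (intervalIntegral.continuous_parametric_intervalIntegral_of_continuous' hg c d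
    ).continuousOn.congr fun u hu => intervalIntegral.integral_congr fun v hv => ?_
  rw [uIcc_of_le hcd] at hv
  exact (hgf u hu v hv).symm

lemma integral_swap {a b c d : ℝ} (hab : a ≤ b) (hcd : c ≤ d) {f : ℝ → ℝ → ℝ}
    (hf : ContinuousOn (fun p : ℝ × ℝ => f p.1 p.2) (Icc a b ×ˢ Icc c d)) :
    ∫ u in a..b, ∫ v in c..d, f u v = ∫ v in c..d, ∫ u in a..b, f u v := by
  obtain ⟨g, hg, hgf⟩ := exists_continuous_extension hab hcd hf
  rw [integral_integral_congr hab hcd fun u hu v hv => (hgf u hu v hv).symm,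
    integral_integral_congr hcd hab fun v hv u hu => (hgf u hu v hv).symm]
  refine MeasureTheory.intervalIntegral_intervalIntegral_swap ?_
  rw [uIoc_of_le hab, uIoc_of_le hcd]
  exact (hg.continuousOn.integrableOn_compact (isCompact_Icc.prod isCompact_Icc)).mono_set
    (prod_mono Ioc_subset_Icc_self Ioc_subset_Icc_self)

/-- Green's theorem on a rectangle, for a form with continuous cross derivatives. -/
lemma green_rectangle {a b c d : ℝ} (hab : a ≤ b) (hcd : c ≤ d) {p q pv qu : ℝ → ℝ → ℝ}
    (hp : ∀ u ∈ Icc a b, ∀ v ∈ Icc c d, HasDerivWithinAt (fun y => p u y) (pv u v) (Icc c d) v)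
    (hq : ∀ u ∈ Icc a b, ∀ v ∈ Icc c d, HasDerivWithinAt (fun x => q x v) (qu u v) (Icc a b) u)
    (hpc : ContinuousOn (fun x : ℝ × ℝ => p x.1 x.2) (Icc a b ×ˢ Icc c d))
    (hqc : ContinuousOn (fun x : ℝ × ℝ => q x.1 x.2) (Icc a b ×ˢ Icc c d))
    (hpv : ContinuousOn (fun x : ℝ × ℝ => pv x.1 x.2) (Icc a b ×ˢ Icc c d))
    (hqu : ContinuousOn (fun x : ℝ × ℝ => qu x.1 x.2) (Icc a b ×ˢ Icc c d)) :
    ∫ u in a..b, ∫ v in c..d, (pv u v - qu u v) =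
      (∫ u in a..b, p u d) - (∫ u in a..b, p u c) -
        ((∫ v in c..d, q b v) - ∫ v in c..d, q a v) := by
  have hi : ∀ {s t : ℝ} {f : ℝ → ℝ}, s ≤ t → ContinuousOn f (Icc s t) →
      IntervalIntegrable f MeasureTheory.volume s t := fun hst hf =>
    ContinuousOn.intervalIntegrable (by rwa [uIcc_of_le hst])
  have h1 : ∫ u in a..b, ∫ v in c..d, pv u v = ∫ u in a..b, (p u d - p u c) := by
    refine intervalIntegral.integral_congr fun u hu => ?_
    rw [uIcc_of_le hab] at hu
    exact integral_of_hasDerivWithinAt_Icc hcd (hp u hu) (continuousOn_slice_right hpv hu)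
  have h2 : ∫ u in a..b, ∫ v in c..d, qu u v = ∫ v in c..d, (q b v - q a v) := by
    rw [integral_swap hab hcd hqu]
    refine intervalIntegral.integral_congr fun v hv => ?_
    rw [uIcc_of_le hcd] at hv
    exact integral_of_hasDerivWithinAt_Icc hab (fun u hu => hq u hu v hv)
      (continuousOn_slice_left hqu hv)
  have h3 : ∫ u in a..b, ∫ v in c..d, (pv u v - qu u v) =
      ∫ u in a..b, ((∫ v in c..d, pv u v) - ∫ v in c..d, qu u v) := by
    refine intervalIntegral.integral_congr fun u hu => ?_
    rw [uIcc_of_le hab] at hu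
    exact intervalIntegral.integral_sub (hi hcd (continuousOn_slice_right hpv hu))
      (hi hcd (continuousOn_slice_right hqu hu))
  rw [h3, intervalIntegral.integral_sub (hi hab (continuousOn_integral_right hab hcd hpv))
    (hi hab (continuousOn_integral_right hab hcd hqu)), h1, h2,
    intervalIntegral.integral_sub (hi hab (continuousOn_slice_left hpc (right_mem_Icc.2 hcd)))
      (hi hab (continuousOn_slice_left hpc (left_mem_Icc.2 hcd))),
    intervalIntegral.integral_sub (hi hcd (continuousOn_slice_right hqc (right_mem_Icc.2 hab)))
      (hi hcd (continuousOn_slice_right hqc (left_mem_Icc.2 hab)))]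

/-! ### Solutions of the Moutard equation -/

/-- `f` is a solution of `f_{uv} = ν f` on `I × J`, with `f_u = fu` and `f_v = fv`. -/
structure MoutardNet {E : Type*} [NormedAddCommGroup E] [NormedSpace ℝ E] (I J : Set ℝ)
    (f fu fv : ℝ → ℝ → E) (ν : ℝ → ℝ → ℝ) : Prop where
  deriv_u : ∀ u ∈ I, ∀ v ∈ J, HasDerivWithinAt (fun x => f x v) (fu u v) I u
  deriv_v : ∀ u ∈ I, ∀ v ∈ J, HasDerivWithinAt (fun y => f u y) (fv u v) J v
  deriv_uv : ∀ u ∈ I, ∀ v ∈ J, HasDerivWithinAt (fun y => fu u y) (ν u v • f u v) J v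
  deriv_vu : ∀ u ∈ I, ∀ v ∈ J, HasDerivWithinAt (fun x => fv x v) (ν u v • f u v) I u
  cont : ContinuousOn (fun p : ℝ × ℝ => f p.1 p.2) (I ×ˢ J)
  cont_u : ContinuousOn (fun p : ℝ × ℝ => fu p.1 p.2) (I ×ˢ J)
  cont_v : ContinuousOn (fun p : ℝ × ℝ => fv p.1 p.2) (I ×ˢ J)
  cont_coeff : ContinuousOn (fun p : ℝ × ℝ => ν p.1 p.2) (I ×ˢ J)

namespace MoutardNet

variable {E F : Type*} [NormedAddCommGroup E] [NormedSpace ℝ E] [NormedAddCommGroup F]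
  [NormedSpace ℝ F] {I J I' J' : Set ℝ} {f fu fv : ℝ → ℝ → E} {ν : ℝ → ℝ → ℝ}

lemma mono (h : MoutardNet I J f fu fv ν) (hI : I' ⊆ I) (hJ : J' ⊆ J) :
    MoutardNet I' J' f fu fv ν where
  deriv_u u hu v hv := (h.deriv_u u (hI hu) v (hJ hv)).mono hI
  deriv_v u hu v hv := (h.deriv_v u (hI hu) v (hJ hv)).mono hJ
  deriv_uv u hu v hv := (h.deriv_uv u (hI hu) v (hJ hv)).mono hJ
  deriv_vu u hu v hv := (h.deriv_vu u (hI hu) v (hJ hv)).mono hI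
  cont := h.cont.mono (prod_mono hI hJ)
  cont_u := h.cont_u.mono (prod_mono hI hJ)
  cont_v := h.cont_v.mono (prod_mono hI hJ)
  cont_coeff := h.cont_coeff.mono (prod_mono hI hJ)

lemma map (h : MoutardNet I J f fu fv ν) (L : E →L[ℝ] F) :
    MoutardNet I J (fun u v => L (f u v)) (fun u v => L (fu u v)) (fun u v => L (fv u v)) ν where
  deriv_u u hu v hv := L.hasFDerivAt.comp_hasDerivWithinAt u (h.deriv_u u hu v hv)
  deriv_v u hu v hv := L.hasFDerivAt.comp_hasDerivWithinAt v (h.deriv_v u hu v hv)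
  deriv_uv u hu v hv := by
    exact (L.hasFDerivAt.comp_hasDerivWithinAt v (h.deriv_uv u hu v hv)).congr_deriv (by simp)
  deriv_vu u hu v hv := by
    exact (L.hasFDerivAt.comp_hasDerivWithinAt u (h.deriv_vu u hu v hv)).congr_deriv (by simp)
  cont := L.continuous.comp_continuousOn h.cont
  cont_u := L.continuous.comp_continuousOn h.cont_u
  cont_v := L.continuous.comp_continuousOn h.cont_v
  cont_coeff := h.cont_coeff

lemma swap (h : MoutardNet I J f fu fv ν) :
    MoutardNet J I (fun v u => f u v) (fun v u => fv u v) (fun v u => fu u v)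
      (fun v u => ν u v) where
  deriv_u v hv u hu := h.deriv_v u hu v hv
  deriv_v v hv u hu := h.deriv_u u hu v hv
  deriv_uv v hv u hu := h.deriv_vu u hu v hv
  deriv_vu v hv u hu := h.deriv_uv u hu v hv
  cont := h.cont.comp continuous_swap.continuousOn fun _ hp => ⟨hp.2, hp.1⟩
  cont_u := h.cont_v.comp continuous_swap.continuousOn fun _ hp => ⟨hp.2, hp.1⟩
  cont_v := h.cont_u.comp continuous_swap.continuousOn fun _ hp => ⟨hp.2, hp.1⟩
  cont_coeff := h.cont_coeff.comp continuous_swap.continuousOn fun _ hp => ⟨hp.2, hp.1⟩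

end MoutardNet

/-- The complex number `⟨X,Y⟩ + i det (n,X,Y)` in coordinates. -/
def coordPairing (x y s xu yu su xv yv sv : ℝ) : ℂ :=
  ⟨xu * xv + yu * yv + su * sv,
    x * (yu * sv - su * yv) + y * (su * xv - xu * sv) + s * (xu * yv - yu * xv)⟩

/-! ### Holonomy of the sphere in a frame over the complement of a pole. -/

section Chart

variable {x y s xu yu su xv yv sv q ν : ℝ}

/-- The tangent vector `(xu,yu,su)` at `(x,y,s)` in the frame that is parallel along the
great circles through `(0,0,1)`; here `q = 1/(1+s)`. -/
def chartVec (x y q xu yu su : ℝ) : ℂ :=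
  ((xu - su * x * q : ℝ) : ℂ) + ((yu - su * y * q : ℝ) : ℂ) * Complex.I

/-- `chartVec` is the rotation that carries `(x,y,s)` to the pole `(0,0,1)` along a great circle,
applied to tangent vectors. It preserves lengths and orientation, hence the complex pairing. -/
lemma conj_chartVec_mul (h1 : x ^ 2 + y ^ 2 + s ^ 2 = 1) (hU : x * xu + y * yu + s * su = 0)
    (hV : x * xv + y * yv + s * sv = 0) (hq : q * (1 + s) = 1) :
    (starRingEnd ℂ) (chartVec x y q xu yu su) * chartVec x y q xv yv sv =
      coordPairing x y s xu yu su xv yv sv := by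
  apply Complex.ext
  · simp only [chartVec, coordPairing, map_add, map_mul, Complex.conj_ofReal, Complex.conj_I,
      Complex.mul_re, Complex.add_re, Complex.ofReal_re, Complex.ofReal_im, Complex.I_re,
      Complex.I_im, Complex.add_im, Complex.mul_im, Complex.neg_re, Complex.neg_im]
    grind
  · simp only [chartVec, coordPairing, map_add, map_mul, Complex.conj_ofReal, Complex.conj_I,
      Complex.mul_re, Complex.add_re, Complex.ofReal_re, Complex.ofReal_im, Complex.I_re,
      Complex.I_im, Complex.add_im, Complex.mul_im, Complex.neg_re, Complex.neg_im]
    grind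

/-- The curve has velocity `(xv,yv,sv)`, and the field `(xu,yu,su)` has a normal derivative, that
is, it is parallel. In the frame it only turns, at a rate given by the connection form `(x dy - y
dx) / (1 + s)`. -/
lemma hasDerivWithinAt_chartVec {I : Set ℝ} {t : ℝ} {x y s xu yu su xv yv sv q : ℝ → ℝ} {ν : ℝ}
    (h1 : x t ^ 2 + y t ^ 2 + s t ^ 2 = 1) (hU : x t * xu t + y t * yu t + s t * su t = 0)
    (hV : x t * xv t + y t * yv t + s t * sv t = 0)
    (hν : ν = -(xu t * xv t + yu t * yv t + su t * sv t)) (hq : q t * (1 + s t) = 1)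
    (hx : HasDerivWithinAt x (xv t) I t) (hy : HasDerivWithinAt y (yv t) I t)
    (hxu : HasDerivWithinAt xu (ν • x t) I t) (hyu : HasDerivWithinAt yu (ν • y t) I t)
    (hsu : HasDerivWithinAt su (ν • s t) I t)
    (hqd : HasDerivWithinAt q (-(sv t * q t ^ 2)) I t) :
    HasDerivWithinAt (fun t => chartVec (x t) (y t) (q t) (xu t) (yu t) (su t))
      (Complex.I * ((x t * yv t - y t * xv t) * q t : ℝ) *
        chartVec (x t) (y t) (q t) (xu t) (yu t) (su t)) I t := by
  have h := ((hxu.sub ((hsu.mul hx).mul hqd)).ofReal_comp).add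
    (((hyu.sub ((hsu.mul hy).mul hqd)).ofReal_comp).mul_const Complex.I)
  refine h.congr_deriv ?_
  simp only [smul_eq_mul, Pi.mul_apply]
  -- `e1` and `e2` are the real and imaginary parts of `z' = i k z`.
  have e1 : ν * x t - ((ν * s t * x t + su t * xv t) * q t + su t * x t * -(sv t * q t ^ 2)) =
      -((x t * yv t - y t * xv t) * q t) * (yu t - su t * y t * q t) := by grind
  have e2 : ν * y t - ((ν * s t * y t + su t * yv t) * q t + su t * y t * -(sv t * q t ^ 2)) =
      ((x t * yv t - y t * xv t) * q t) * (xu t - su t * x t * q t) := by grind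
  rw [e1, e2]
  apply Complex.ext <;> simp [chartVec]

/-- With `D = z̄ w`, the phases that `z` gains along the two `v`-sides and `w` along the two
`u`-sides combine to the integral of the connection form around the rectangle, and Green's theorem
makes this the integral of the curvature. The pole condition keeps `1/(1+s)` finite. -/
lemma holonomy_of_chart {u₀ u₁ v₀ v₁ : ℝ} (hu : u₀ ≤ u₁) (hv : v₀ ≤ v₁)
    {x y s xu yu su xv yv sv ν : ℝ → ℝ → ℝ}
    (hx : MoutardNet (Icc u₀ u₁) (Icc v₀ v₁) x xu xv ν)
    (hy : MoutardNet (Icc u₀ u₁) (Icc v₀ v₁) y yu yv ν)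
    (hs : MoutardNet (Icc u₀ u₁) (Icc v₀ v₁) s su sv ν)
    (h1 : ∀ u ∈ Icc u₀ u₁, ∀ v ∈ Icc v₀ v₁, x u v ^ 2 + y u v ^ 2 + s u v ^ 2 = 1)
    (hU : ∀ u ∈ Icc u₀ u₁, ∀ v ∈ Icc v₀ v₁, x u v * xu u v + y u v * yu u v + s u v * su u v = 0)
    (hV : ∀ u ∈ Icc u₀ u₁, ∀ v ∈ Icc v₀ v₁, x u v * xv u v + y u v * yv u v + s u v * sv u v = 0)
    (hν : ∀ u ∈ Icc u₀ u₁, ∀ v ∈ Icc v₀ v₁,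
      ν u v = -(xu u v * xv u v + yu u v * yv u v + su u v * sv u v))
    (hpole : ∀ u ∈ Icc u₀ u₁, ∀ v ∈ Icc v₀ v₁, -1 < s u v) {D : ℝ → ℝ → ℂ}
    (hD : ∀ u ∈ Icc u₀ u₁, ∀ v ∈ Icc v₀ v₁, D u v = coordPairing (x u v) (y u v) (s u v)
      (xu u v) (yu u v) (su u v) (xv u v) (yv u v) (sv u v)) :
    D u₀ v₀ * D u₁ v₁ =
      Complex.exp (Complex.I * (-∫ u in u₀..u₁, ∫ v in v₀..v₁, (D u v).im : ℝ)) *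
        (D u₁ v₀ * D u₀ v₁) := by
  set I := Icc u₀ u₁
  set J := Icc v₀ v₁
  set q : ℝ → ℝ → ℝ := fun u v => (1 + s u v)⁻¹ with hqdef
  have hne : ∀ u ∈ I, ∀ v ∈ J, 1 + s u v ≠ 0 := fun u hu v hv => by
    linarith [hpole u hu v hv] |> fun h : 0 < 1 + s u v => h.ne'
  have hq : ∀ u ∈ I, ∀ v ∈ J, q u v * (1 + s u v) = 1 := fun u hu v hv =>
    inv_mul_cancel₀ (hne u hu v hv)
  have hqu : ∀ u ∈ I, ∀ v ∈ J,
      HasDerivWithinAt (fun x => q x v) (-(su u v * q u v ^ 2)) I u := fun u hu v hv => by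
    refine (((hs.deriv_u u hu v hv).const_add 1).inv (hne u hu v hv)).congr_deriv ?_
    simp only [hqdef]; field_simp
  have hqv : ∀ u ∈ I, ∀ v ∈ J,
      HasDerivWithinAt (fun y => q u y) (-(sv u v * q u v ^ 2)) J v := fun u hu v hv => by
    refine (((hs.deriv_v u hu v hv).const_add 1).inv (hne u hu v hv)).congr_deriv ?_
    simp only [hqdef]; field_simp
  have hqc : ContinuousOn (fun p : ℝ × ℝ => q p.1 p.2) (I ×ˢ J) :=
    (continuousOn_const.add hs.cont).inv₀ fun p hp => hne p.1 hp.1 p.2 hp.2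
  set z : ℝ → ℝ → ℂ := fun u v => chartVec (x u v) (y u v) (q u v) (xu u v) (yu u v) (su u v)
  set w : ℝ → ℝ → ℂ := fun u v => chartVec (x u v) (y u v) (q u v) (xv u v) (yv u v) (sv u v)
  set kv : ℝ → ℝ → ℝ := fun u v => (x u v * yv u v - y u v * xv u v) * q u v
  set ku : ℝ → ℝ → ℝ := fun u v => (x u v * yu u v - y u v * xu u v) * q u v
  have cx := hx.cont
  have cy := hy.cont
  have cxu := hx.cont_u
  have cyu := hy.cont_u
  have csu := hs.cont_u
  have cxv := hx.cont_v
  have cyv := hy.cont_v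
  have csv := hs.cont_v
  have hkvc : ContinuousOn (fun p : ℝ × ℝ => kv p.1 p.2) (I ×ˢ J) := by fun_prop
  have hkuc : ContinuousOn (fun p : ℝ × ℝ => ku p.1 p.2) (I ×ˢ J) := by fun_prop
  have hz : ∀ u ∈ I, z u v₁ = z u v₀ * Complex.exp (Complex.I * (∫ v in v₀..v₁, kv u v : ℝ)) :=
    fun u hu => linear_ode hv (continuousOn_slice_right hkvc hu) fun v hv =>
      hasDerivWithinAt_chartVec (h1 u hu v hv) (hU u hu v hv) (hV u hu v hv) (hν u hu v hv)
        (hq u hu v hv) (hx.deriv_v u hu v hv) (hy.deriv_v u hu v hv) (hx.deriv_uv u hu v hv)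
        (hy.deriv_uv u hu v hv) (hs.deriv_uv u hu v hv) (hqv u hu v hv)
  have hw : ∀ v ∈ J, w u₁ v = w u₀ v * Complex.exp (Complex.I * (∫ u in u₀..u₁, ku u v : ℝ)) :=
    fun v hv => linear_ode hu (continuousOn_slice_left hkuc hv) fun u hu =>
      hasDerivWithinAt_chartVec (x := fun u => x u v) (y := fun u => y u v) (s := fun u => s u v)
        (xu := fun u => xv u v) (yu := fun u => yv u v) (su := fun u => sv u v)
        (xv := fun u => xu u v) (yv := fun u => yu u v) (sv := fun u => su u v)
        (q := fun u => q u v)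
        (h1 u hu v hv) (hV u hu v hv) (hU u hu v hv) (by rw [hν u hu v hv]; ring)
        (hq u hu v hv) (hx.deriv_u u hu v hv) (hy.deriv_u u hu v hv) (hx.deriv_vu u hu v hv)
        (hy.deriv_vu u hu v hv) (hs.deriv_vu u hu v hv) (hqu u hu v hv)
  have hzw : ∀ u ∈ I, ∀ v ∈ J, D u v = (starRingEnd ℂ) (z u v) * w u v := fun u hu v hv => by
    rw [hD u hu v hv]
    exact (conj_chartVec_mul (h1 u hu v hv) (hU u hu v hv) (hV u hu v hv) (hq u hu v hv)).symm
  -- `ku` is differentiated only in `v` and `kv` only in `u`, so no pure second derivative appears;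
  -- the terms with `ν` cancel.
  have hgreen := green_rectangle hu hv (p := ku) (q := kv)
    (pv := fun u v => (xv u v * yu u v - yv u v * xu u v) * q u v -
      (x u v * yu u v - y u v * xu u v) * (sv u v * q u v ^ 2))
    (qu := fun u v => (xu u v * yv u v - yu u v * xv u v) * q u v -
      (x u v * yv u v - y u v * xv u v) * (su u v * q u v ^ 2))
    (fun u hu v hv => by
      refine ((((hx.deriv_v u hu v hv).mul (hy.deriv_uv u hu v hv)).sub
        ((hy.deriv_v u hu v hv).mul (hx.deriv_uv u hu v hv))).mul (hqv u hu v hv)).congr_deriv ?_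
      simp only [smul_eq_mul, Pi.mul_apply, Pi.sub_apply]; ring)
    (fun u hu v hv => by
      refine ((((hx.deriv_u u hu v hv).mul (hy.deriv_vu u hu v hv)).sub
        ((hy.deriv_u u hu v hv).mul (hx.deriv_vu u hu v hv))).mul (hqu u hu v hv)).congr_deriv ?_
      simp only [smul_eq_mul, Pi.mul_apply, Pi.sub_apply]; ring)
    hkuc hkvc (by fun_prop) (by fun_prop)
  -- The sphere has curvature one: the curl of the connection form is minus the Jacobian.
  rw [integral_integral_congr hu hv (g := fun u v => -(D u v).im) fun u hu v hv => by
    have a1 := h1 u hu v hv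
    have a2 := hU u hu v hv
    have a3 := hV u hu v hv
    have a4 := hq u hu v hv
    rw [hD u hu v hv, coordPairing]
    grind] at hgreen
  simp only [intervalIntegral.integral_neg] at hgreen
  have m0 : u₀ ∈ I := left_mem_Icc.2 hu
  have m1 : u₁ ∈ I := right_mem_Icc.2 hu
  have n0 : v₀ ∈ J := left_mem_Icc.2 hv
  have n1 : v₁ ∈ J := right_mem_Icc.2 hv
  rw [hgreen, hzw _ m0 _ n0, hzw _ m1 _ n1, hzw _ m1 _ n0, hzw _ m0 _ n1, hz _ m1, hz _ m0,
    hw _ n0, hw _ n1]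
  simp only [map_mul, ← Complex.exp_conj, Complex.conj_I, Complex.conj_ofReal, Complex.ofReal_sub,
    mul_sub, Complex.exp_sub, neg_mul, Complex.exp_neg]
  have e : ∀ c : ℂ, Complex.exp c ≠ 0 := Complex.exp_ne_zero
  field_simp [e]

end Chart

/-! ### Parallel fields and spherical nets. -/

lemma eq_of_hasDerivWithinAt_zero {E : Type*} [NormedAddCommGroup E] [NormedSpace ℝ E] {a b : ℝ}
    {f : ℝ → E} (hf : ∀ t ∈ Icc a b, HasDerivWithinAt f 0 (Icc a b) t) :
    ∀ t ∈ Icc a b, f t = f a :=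
  constant_of_has_deriv_right_zero (fun t ht => (hf t ht).continuousWithinAt)
    (fun t ht => ((hf t (Ico_subset_Icc_self ht)).mono_of_mem_nhdsWithin
      (Icc_mem_nhdsGE_of_mem ht)))

lemma eq_zero_of_hasDerivWithinAt_of_const {a c d t : ℝ} (ha : 0 < a) {f : ℝ → ℝ}
    (hf : HasDerivWithinAt f d (Icc 0 a) t) (hc : ∀ t ∈ Icc 0 a, f t = c) (ht : t ∈ Icc 0 a) :
    d = 0 := by
  refine (uniqueDiffOn_Icc ha t ht).eq_deriv _ hf ?_
  exact (hasDerivWithinAt_const t (Icc 0 a) c).congr hc (hc t ht)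

lemma hasDerivWithinAt_coord {s : Set ℝ} {f : ℝ → Space} {f' : Space} {t : ℝ}
    (h : HasDerivWithinAt f f' s t) (i : Fin 3) : HasDerivWithinAt (fun t => f t i) (f' i) s t :=
  (EuclideanSpace.proj (𝕜 := ℝ) i).hasFDerivAt.comp_hasDerivWithinAt t h

lemma hasDerivWithinAt_inner {s : Set ℝ} {f g : ℝ → Space} {f' g' : Space} {t : ℝ}
    (hf : HasDerivWithinAt f f' s t) (hg : HasDerivWithinAt g g' s t) :
    HasDerivWithinAt (fun t => inner ℝ (f t) (g t)) (inner ℝ (f t) g' + inner ℝ f' (g t)) s t :=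
  hf.inner ℝ hg

/-- `X` is a tangent field that is parallel along the spherical curve `n`. -/
structure IsParallel (a : ℝ) (n n' X : ℝ → Space) (μ : ℝ → ℝ) : Prop where
  unit : ∀ t ∈ Icc 0 a, ‖n t‖ = 1
  deriv_curve : ∀ t ∈ Icc 0 a, HasDerivWithinAt n (n' t) (Icc 0 a) t
  orth_deriv : ∀ t ∈ Icc 0 a, inner ℝ (n t) (n' t) = 0
  orth : ∀ t ∈ Icc 0 a, inner ℝ (n t) (X t) = 0
  deriv : ∀ t ∈ Icc 0 a, HasDerivWithinAt X (μ t • n t) (Icc 0 a) t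

/-- Parallel transport acts by rotations of the tangent planes. For the imaginary part, the
derivative of `det (n,X,Y)` reduces to `det (n',X,Y)`, which vanishes because all three vectors lie
in the tangent plane. -/
lemma IsParallel.pairing_eq {a : ℝ} {n n' X Y : ℝ → Space} {μ ξ : ℝ → ℝ}
    (hX : IsParallel a n n' X μ) (hY : IsParallel a n n' Y ξ) {t : ℝ} (ht : t ∈ Icc 0 a) :
    pairing (n t) (X t) (Y t) = pairing (n 0) (X 0) (Y 0) := by
  apply Complex.ext
  · refine eq_of_hasDerivWithinAt_zero (f := fun t => inner ℝ (X t) (Y t)) (fun t ht => ?_) t ht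
    refine (hasDerivWithinAt_inner (hX.deriv t ht) (hY.deriv t ht)).congr_deriv ?_
    rw [inner_smul_right, inner_smul_left, real_inner_comm, hX.orth t ht, hY.orth t ht]
    simp
  · refine eq_of_hasDerivWithinAt_zero (f := fun t => inner ℝ (n t) (cross (X t) (Y t)))
      (fun t ht => ?_) t ht
    have hn := hasDerivWithinAt_coord (hX.deriv_curve t ht)
    have dX := hasDerivWithinAt_coord (hX.deriv t ht)
    have dY := hasDerivWithinAt_coord (hY.deriv t ht)
    simp only [inner_coord, cross_zero, cross_one, cross_two]
    refine ((((hn 0).mul (((dX 1).mul (dY 2)).sub ((dX 2).mul (dY 1)))).add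
      ((hn 1).mul (((dX 2).mul (dY 0)).sub ((dX 0).mul (dY 2))))).add
      ((hn 2).mul (((dX 0).mul (dY 1)).sub ((dX 1).mul (dY 0))))).congr_deriv ?_
    have h1 := normSq_coord (n t)
    have h2 := hX.orth_deriv t ht
    have h3 := hX.orth t ht
    have h4 := hY.orth t ht
    rw [hX.unit t ht] at h1
    simp only [inner_coord] at h2 h3 h4
    simp only [PiLp.smul_apply, smul_eq_mul, Pi.mul_apply, Pi.sub_apply]
    -- Cramer's rule: `|n|² det (n',X,Y)` is the sum of `⟨n,n'⟩`, `⟨n,X⟩`, `⟨n,Y⟩` times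
    -- determinants in which `n` replaces the respective vector.
    linear_combination
      (n' t 0 * (X t 1 * Y t 2 - X t 2 * Y t 1) + n' t 1 * (X t 2 * Y t 0 - X t 0 * Y t 2) +
        n' t 2 * (X t 0 * Y t 1 - X t 1 * Y t 0)) * h1 +
      (n t 0 * (X t 1 * Y t 2 - X t 2 * Y t 1) + n t 1 * (X t 2 * Y t 0 - X t 0 * Y t 2) +
        n t 2 * (X t 0 * Y t 1 - X t 1 * Y t 0)) * h2 +
      (n t 0 * (Y t 1 * n' t 2 - Y t 2 * n' t 1) + n t 1 * (Y t 2 * n' t 0 - Y t 0 * n' t 2) +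
        n t 2 * (Y t 0 * n' t 1 - Y t 1 * n' t 0)) * h3 +
      (n t 0 * (n' t 1 * X t 2 - n' t 2 * X t 1) + n t 1 * (n' t 2 * X t 0 - n' t 0 * X t 2) +
        n t 2 * (n' t 0 * X t 1 - n' t 1 * X t 0)) * h4

lemma IsParallel.norm_eq {a : ℝ} {n n' X : ℝ → Space} {μ : ℝ → ℝ}
    (hX : IsParallel a n n' X μ) {t : ℝ} (ht : t ∈ Icc 0 a) : ‖X t‖ = ‖X 0‖ := by
  have h := congrArg Complex.re (hX.pairing_eq hX ht)
  simp only [pairing, real_inner_self_eq_norm_sq] at h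
  exact (sq_eq_sq₀ (norm_nonneg _) (norm_nonneg _)).1 h

/-- A spherical solution of the Moutard equation on a rectangle. -/
structure SphericalNet (a b : ℝ) (N U V : ℝ → ℝ → Space) (ν : ℝ → ℝ → ℝ) : Prop where
  pos_u : 0 < a
  pos_v : 0 < b
  net : MoutardNet (Icc 0 a) (Icc 0 b) N U V ν
  unit : ∀ u ∈ Icc 0 a, ∀ v ∈ Icc 0 b, ‖N u v‖ = 1

namespace SphericalNet

variable {a b : ℝ} {N U V : ℝ → ℝ → Space} {ν : ℝ → ℝ → ℝ}

lemma swap (h : SphericalNet a b N U V ν) :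
    SphericalNet b a (fun v u => N u v) (fun v u => V u v) (fun v u => U u v)
      (fun v u => ν u v) where
  pos_u := h.pos_v
  pos_v := h.pos_u
  net := h.net.swap
  unit v hv u hu := h.unit u hu v hv

lemma orth_u (h : SphericalNet a b N U V ν) {u v : ℝ} (hu : u ∈ Icc 0 a) (hv : v ∈ Icc 0 b) :
    inner ℝ (N u v) (U u v) = 0 := by
  have hd := hasDerivWithinAt_inner (h.net.deriv_u u hu v hv) (h.net.deriv_u u hu v hv)
  have := eq_zero_of_hasDerivWithinAt_of_const h.pos_u hd (c := 1)
    (fun u hu => by rw [real_inner_self_eq_norm_sq, h.unit u hu v hv, one_pow]) hu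
  rw [real_inner_comm (N u v) (U u v)] at this
  linarith

lemma orth_v (h : SphericalNet a b N U V ν) {u v : ℝ} (hu : u ∈ Icc 0 a) (hv : v ∈ Icc 0 b) :
    inner ℝ (N u v) (V u v) = 0 :=
  h.swap.orth_u hv hu

lemma coeff_eq (h : SphericalNet a b N U V ν) {u v : ℝ} (hu : u ∈ Icc 0 a) (hv : v ∈ Icc 0 b) :
    ν u v = -inner ℝ (U u v) (V u v) := by
  have hd := hasDerivWithinAt_inner (h.net.deriv_v u hu v hv) (h.net.deriv_uv u hu v hv)
  have := eq_zero_of_hasDerivWithinAt_of_const h.pos_v hd (c := 0)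
    (fun v hv => h.orth_u hu hv) hv
  rw [inner_smul_right, real_inner_self_eq_norm_sq, h.unit u hu v hv, real_inner_comm] at this
  linarith

/-- The Moutard equation read geometrically: the `u`-derivative of `N_v` is normal to the sphere. -/
lemma isParallel_v (h : SphericalNet a b N U V ν) {v : ℝ} (hv : v ∈ Icc 0 b) :
    IsParallel a (fun u => N u v) (fun u => U u v) (fun u => V u v) (fun u => ν u v) where
  unit u hu := h.unit u hu v hv
  deriv_curve u hu := h.net.deriv_u u hu v hv
  orth_deriv _ hu := h.orth_u hu hv
  orth _ hu := h.orth_v hu hv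
  deriv u hu := h.net.deriv_vu u hu v hv

lemma norm_v (h : SphericalNet a b N U V ν) {u v : ℝ} (hu : u ∈ Icc 0 a) (hv : v ∈ Icc 0 b) :
    ‖V u v‖ = ‖V 0 v‖ :=
  (h.isParallel_v hv).norm_eq hu

lemma norm_u (h : SphericalNet a b N U V ν) {u v : ℝ} (hu : u ∈ Icc 0 a) (hv : v ∈ Icc 0 b) :
    ‖U u v‖ = ‖U u 0‖ :=
  h.swap.norm_v hv hu

lemma continuousOn_inner {s : Set (ℝ × ℝ)} {f g : ℝ × ℝ → Space} (hf : ContinuousOn f s)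
    (hg : ContinuousOn g s) : ContinuousOn (fun p => (inner ℝ (f p) (g p) : ℝ)) s := hf.inner hg

lemma holonomy (h : SphericalNet a b N U V ν) {u₀ u₁ v₀ v₁ : ℝ} (hu0 : 0 ≤ u₀) (hu : u₀ ≤ u₁)
    (hu1 : u₁ ≤ a) (hv0 : 0 ≤ v₀) (hv : v₀ ≤ v₁) (hv1 : v₁ ≤ b)
    (hpole : (∀ u ∈ Icc u₀ u₁, ∀ v ∈ Icc v₀ v₁, -1 < N u v 2) ∨
      ∀ u ∈ Icc u₀ u₁, ∀ v ∈ Icc v₀ v₁, N u v 2 < 1) {D : ℝ → ℝ → ℂ}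
    (hD : ∀ u v, D u v = pairing (N u v) (U u v) (V u v)) :
    D u₀ v₀ * D u₁ v₁ =
      Complex.exp (Complex.I * (-∫ u in u₀..u₁, ∫ v in v₀..v₁, (D u v).im : ℝ)) *
        (D u₁ v₀ * D u₀ v₁) := by
  have hI : Icc u₀ u₁ ⊆ Icc 0 a := Icc_subset_Icc hu0 hu1
  have hJ : Icc v₀ v₁ ⊆ Icc 0 b := Icc_subset_Icc hv0 hv1
  have hn := h.net.mono hI hJ
  have hc := fun i => hn.map (EuclideanSpace.proj i : Space →L[ℝ] ℝ)
  have hc' := fun i => hn.map (-EuclideanSpace.proj i : Space →L[ℝ] ℝ)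
  have e1 : ∀ u ∈ Icc u₀ u₁, ∀ v ∈ Icc v₀ v₁, _ := fun u hu v hv => by
    have := normSq_coord (N u v)
    rw [h.unit u (hI hu) v (hJ hv)] at this
    exact this
  have e2 : ∀ u ∈ Icc u₀ u₁, ∀ v ∈ Icc v₀ v₁, _ := fun u hu v hv =>
    (inner_coord _ _).symm.trans (h.orth_u (hI hu) (hJ hv))
  have e3 : ∀ u ∈ Icc u₀ u₁, ∀ v ∈ Icc v₀ v₁, _ := fun u hu v hv =>
    (inner_coord _ _).symm.trans (h.orth_v (hI hu) (hJ hv))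
  have e4 : ∀ u ∈ Icc u₀ u₁, ∀ v ∈ Icc v₀ v₁, _ := fun u hu v hv =>
    (h.coeff_eq (hI hu) (hJ hv)).trans (congrArg Neg.neg (inner_coord _ _))
  rcases hpole with hp | hp
  · refine holonomy_of_chart hu hv (hc 0) (hc 1) (hc 2) ?_ ?_ ?_ ?_ hp ?_
    · intro u hu v hv
      have := e1 u hu v hv
      simp only [EuclideanSpace.coe_proj]
      linarith
    · intro u hu v hv; exact e2 u hu v hv
    · intro u hu v hv; exact e3 u hu v hv
    · intro u hu v hv; exact e4 u hu v hv
    · intro u hu v hv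
      rw [hD, pairing, coordPairing, inner_coord, inner_coord, cross_zero, cross_one, cross_two]
      rfl
  -- The half-turn `(x,y,s) ↦ (x,-y,-s)` exchanges the poles and preserves orientation, hence leaves
  -- `D` unchanged.
  · refine holonomy_of_chart hu hv (hc 0) (hc' 1) (hc' 2) ?_ ?_ ?_ ?_ ?_ ?_
    · intro u hu v hv
      have := e1 u hu v hv
      simp only [EuclideanSpace.coe_proj, neg_apply, neg_sq]
      linarith
    · intro u hu v hv
      have := e2 u hu v hv
      simp only [EuclideanSpace.coe_proj, neg_apply, neg_mul_neg]
      exact this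
    · intro u hu v hv
      have := e3 u hu v hv
      simp only [EuclideanSpace.coe_proj, neg_apply, neg_mul_neg]
      exact this
    · intro u hu v hv
      have := e4 u hu v hv
      simp only [EuclideanSpace.coe_proj, neg_apply, neg_mul_neg]
      exact this
    · intro u hu v hv
      exact neg_lt_neg (hp u hu v hv)
    · intro u hu v hv
      rw [hD, pairing, coordPairing, inner_coord, inner_coord, cross_zero, cross_one, cross_two]
      simp only [EuclideanSpace.coe_proj, neg_apply]
      congr 1 <;> ring

end SphericalNet

/-- `φ` is an angle between `U` and `V` that satisfies `|U||V| e^{iφ} = -σ ⟨⟨U,V⟩⟩`, where `σ = ±1`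
and `⟨⟨U,V⟩⟩` is the complex pairing in the tangent planes of the sphere. -/
structure IsAngle (a b : ℝ) (N U V : ℝ → ℝ → Space) (σ : ℝ) (φ : ℝ → ℝ → ℝ) : Prop where
  sign_sq : σ ^ 2 = 1
  ne_u : ∀ u ∈ Icc 0 a, ∀ v ∈ Icc 0 b, U u v ≠ 0
  ne_v : ∀ u ∈ Icc 0 a, ∀ v ∈ Icc 0 b, V u v ≠ 0
  mem : ∀ u ∈ Icc 0 a, ∀ v ∈ Icc 0 b, φ u v ∈ Ioo 0 Real.pi
  cont : ContinuousOn (fun p : ℝ × ℝ => φ p.1 p.2) (Icc 0 a ×ˢ Icc 0 b)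
  exp_eq : ∀ u ∈ Icc 0 a, ∀ v ∈ Icc 0 b,
    ((‖U u v‖ * ‖V u v‖ : ℝ) : ℂ) * Complex.exp (Complex.I * φ u v) =
      -σ * pairing (N u v) (U u v) (V u v)

/-! ### From congruences modulo `2π` to equalities. -/

lemma eq_zero_of_exp_eq_one {x : ℝ} (h : Complex.exp (Complex.I * x) = 1)
    (hx : |x| < 2 * Real.pi) : x = 0 := by
  obtain ⟨n, hn⟩ := Complex.exp_eq_one_iff.1 h
  have hx' : x = n * (2 * Real.pi) := by
    have : (x : ℂ) = ((n * (2 * Real.pi) : ℝ) : ℂ) := by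
      apply mul_left_cancel₀ Complex.I_ne_zero
      rw [hn]; push_cast; ring
    exact_mod_cast this
  have hpi := Real.pi_pos
  rw [hx', abs_mul, abs_of_pos (by positivity : 0 < 2 * Real.pi)] at hx
  have h1 : |(n : ℝ)| < 1 := by
    by_contra hc
    push Not at hc
    nlinarith
  have h2 : n = 0 := by
    rw [← Int.abs_lt_one_iff]
    exact_mod_cast h1
  simp [hx', h2]

/-- Cut the interval into steps of length `δ` and induct on their number. -/
lemma additive_eq_zero {a δ : ℝ} (hδ : 0 < δ) {G : ℝ → ℝ → ℝ}
    (hadd : ∀ r s t, 0 ≤ r → r ≤ s → s ≤ t → t ≤ a → G r t = G r s + G s t)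
    (hsmall : ∀ s t, 0 ≤ s → s ≤ t → t ≤ a → t - s ≤ δ → G s t = 0) :
    ∀ s t, 0 ≤ s → s ≤ t → t ≤ a → G s t = 0 := by
  have key : ∀ n : ℕ, ∀ s t, 0 ≤ s → s ≤ t → t ≤ a → t - s ≤ n * δ → G s t = 0 := by
    intro n
    induction n with
    | zero =>
      intro s t hs hst hta h
      exact hsmall s t hs hst hta (by simp at h; linarith)
    | succ n ih =>
      intro s t hs hst hta h
      push_cast at h
      rcases le_total t (s + δ) with ht | ht
      · exact hsmall s t hs hst hta (by linarith)
      · rw [hadd s (s + δ) t hs (by linarith) ht hta,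
          hsmall s (s + δ) hs (by linarith) (by linarith) (by linarith),
          ih (s + δ) t (by linarith) ht hta (by linarith), add_zero]
  intro s t hs hst hta
  obtain ⟨n, hn⟩ := exists_nat_ge ((t - s) / δ)
  exact key n s t hs hst hta ((div_le_iff₀ hδ).1 hn)

lemma intervalIntegrable_slice {a c d : ℝ} {g : ℝ → ℝ} (hg : ContinuousOn g (Icc 0 a))
    (h0 : 0 ≤ c) (hcd : c ≤ d) (hd : d ≤ a) :
    IntervalIntegrable g MeasureTheory.volume c d := by
  refine (hg.mono ?_).intervalIntegrable
  rw [uIcc_of_le hcd]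
  exact Icc_subset_Icc h0 hd

section Rectangle

variable {a b : ℝ} {f : ℝ → ℝ → ℝ}

lemma integral_add_left (hf : ContinuousOn (fun p : ℝ × ℝ => f p.1 p.2) (Icc 0 a ×ˢ Icc 0 b))
    {r s t c d : ℝ} (h0 : 0 ≤ r) (hrs : r ≤ s) (hst : s ≤ t) (hta : t ≤ a)
    (hc : 0 ≤ c) (hcd : c ≤ d) (hd : d ≤ b) :
    ∫ u in r..t, ∫ v in c..d, f u v =
      (∫ u in r..s, ∫ v in c..d, f u v) + ∫ u in s..t, ∫ v in c..d, f u v := by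
  have hg : ContinuousOn (fun u => ∫ v in c..d, f u v) (Icc 0 a) :=
    continuousOn_integral_right (by linarith) hcd
      (hf.mono (prod_mono subset_rfl (Icc_subset_Icc hc hd)))
  exact (intervalIntegral.integral_add_adjacent_intervals
    (intervalIntegrable_slice hg h0 hrs (by linarith))
    (intervalIntegrable_slice hg (by linarith) hst hta)).symm

lemma integral_add_right (hf : ContinuousOn (fun p : ℝ × ℝ => f p.1 p.2) (Icc 0 a ×ˢ Icc 0 b))
    {r s t c d : ℝ} (h0 : 0 ≤ r) (hrs : r ≤ s) (hst : s ≤ t) (htb : t ≤ b)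
    (hc : 0 ≤ c) (hcd : c ≤ d) (hd : d ≤ a) :
    ∫ u in c..d, ∫ v in r..t, f u v =
      (∫ u in c..d, ∫ v in r..s, f u v) + ∫ u in c..d, ∫ v in s..t, f u v := by
  have hm : ∀ {x y : ℝ}, 0 ≤ x → y ≤ b → ContinuousOn (fun p : ℝ × ℝ => f p.1 p.2)
      (Icc c d ×ˢ Icc x y) := fun hx hy =>
    hf.mono (prod_mono (Icc_subset_Icc hc hd) (Icc_subset_Icc hx hy))
  rw [integral_swap hcd (hrs.trans hst) (hm h0 htb),
    integral_swap hcd hrs (hm h0 (hst.trans htb)), integral_swap hcd hst (hm (h0.trans hrs) htb)]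
  exact integral_add_left (f := fun v u => f u v)
    (hf.comp continuous_swap.continuousOn fun _ hp => ⟨hp.2, hp.1⟩) h0 hrs hst htb hc hcd hd

lemma abs_integral_le {M c d r s : ℝ} (hcd : c ≤ d) (hrs : r ≤ s)
    (hM : ∀ u ∈ Icc c d, ∀ v ∈ Icc r s, |f u v| ≤ M) :
    |∫ u in c..d, ∫ v in r..s, f u v| ≤ M * (s - r) * (d - c) := by
  have h := intervalIntegral.norm_integral_le_of_norm_le_const (a := c) (b := d)
    (f := fun u => ∫ v in r..s, f u v) (C := M * (s - r)) (fun u hu => by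
      rw [uIoc_of_le hcd] at hu
      have h := intervalIntegral.norm_integral_le_of_norm_le_const (a := r) (b := s)
        (f := fun v => f u v) (C := M) (fun v hv => by
          rw [uIoc_of_le hrs] at hv
          exact hM u (Ioc_subset_Icc_self hu) v (Ioc_subset_Icc_self hv))
      rwa [abs_of_nonneg (by linarith : 0 ≤ s - r)] at h)
  rwa [abs_of_nonneg (by linarith : 0 ≤ d - c)] at h

end Rectangle

/-! ### Hazzidakis' formula. -/

namespace SphericalNet

variable {a b σ : ℝ} {N U V : ℝ → ℝ → Space} {ν φ : ℝ → ℝ → ℝ}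

/-- The Jacobian of `N` as a map into the sphere. -/
def jacobian (N U V : ℝ → ℝ → Space) (u v : ℝ) : ℝ := inner ℝ (N u v) (cross (U u v) (V u v))

/-- The holonomy identity expressed through `φ`. The norms cancel because those of `N_u` and `N_v`
each depend on one coordinate only, and the signs cancel because `σ² = 1`. -/
lemma exp_defect (h : SphericalNet a b N U V ν) (hφ : IsAngle a b N U V σ φ) {u₀ u₁ v₀ v₁ : ℝ}
    (hu0 : 0 ≤ u₀) (hu : u₀ ≤ u₁)
    (hu1 : u₁ ≤ a) (hv0 : 0 ≤ v₀) (hv : v₀ ≤ v₁) (hv1 : v₁ ≤ b)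
    (hpole : (∀ u ∈ Icc u₀ u₁, ∀ v ∈ Icc v₀ v₁, -1 < N u v 2) ∨
      ∀ u ∈ Icc u₀ u₁, ∀ v ∈ Icc v₀ v₁, N u v 2 < 1) :
    Complex.exp (Complex.I * (φ u₀ v₀ + φ u₁ v₁ - φ u₁ v₀ - φ u₀ v₁ +
      ∫ u in u₀..u₁, ∫ v in v₀..v₁, jacobian N U V u v : ℝ)) = 1 := by
  have mu0 : u₀ ∈ Icc 0 a := ⟨hu0, hu.trans hu1⟩
  have mu1 : u₁ ∈ Icc 0 a := ⟨hu0.trans hu, hu1⟩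
  have mv0 : v₀ ∈ Icc 0 b := ⟨hv0, hv.trans hv1⟩
  have mv1 : v₁ ∈ Icc 0 b := ⟨hv0.trans hv, hv1⟩
  have hol := h.holonomy hu0 hu hu1 hv0 hv hv1 hpole (fun _ _ => rfl)
  simp only [pairing] at hol
  change pairing _ _ _ * pairing _ _ _ = Complex.exp (Complex.I * (-∫ u in u₀..u₁,
    ∫ v in v₀..v₁, jacobian N U V u v : ℝ)) * (pairing _ _ _ * pairing _ _ _) at hol
  set K := ∫ u in u₀..u₁, ∫ v in v₀..v₁, jacobian N U V u v
  have e00 := hφ.exp_eq _ mu0 _ mv0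
  have e01 := hφ.exp_eq _ mu0 _ mv1
  have e10 := hφ.exp_eq _ mu1 _ mv0
  have e11 := hφ.exp_eq _ mu1 _ mv1
  have n1 := norm_ne_zero_iff.2 (hφ.ne_u _ mu0 _ mv0)
  have n2 := norm_ne_zero_iff.2 (hφ.ne_u _ mu1 _ mv0)
  have n3 := norm_ne_zero_iff.2 (hφ.ne_v _ mu0 _ mv0)
  have n4 := norm_ne_zero_iff.2 (hφ.ne_v _ mu0 _ mv1)
  rw [h.norm_u mu0 mv1, ← h.norm_u mu0 mv0] at e01
  rw [h.norm_u mu1 mv1, ← h.norm_u mu1 mv0, h.norm_v mu1 mv1, ← h.norm_v mu0 mv1] at e11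
  rw [h.norm_v mu1 mv0, ← h.norm_v mu0 mv0] at e10
  set A : ℂ := ((‖U u₀ v₀‖ * ‖V u₀ v₀‖ : ℝ) : ℂ) * ((‖U u₁ v₀‖ * ‖V u₀ v₁‖ : ℝ) : ℂ) with hA
  have hA0 : A ≠ 0 := by
    rw [hA]; exact_mod_cast mul_ne_zero (mul_ne_zero n1 n3) (mul_ne_zero n2 n4)
  have key : A * (Complex.exp (Complex.I * φ u₀ v₀) * Complex.exp (Complex.I * φ u₁ v₁)) =
      A * (Complex.exp (Complex.I * (-K : ℝ)) *
        (Complex.exp (Complex.I * φ u₁ v₀) * Complex.exp (Complex.I * φ u₀ v₁))) := by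
    have l : A * (Complex.exp (Complex.I * φ u₀ v₀) * Complex.exp (Complex.I * φ u₁ v₁)) =
        σ ^ 2 * (pairing (N u₀ v₀) (U u₀ v₀) (V u₀ v₀) *
          pairing (N u₁ v₁) (U u₁ v₁) (V u₁ v₁)) := by
      linear_combination ((‖U u₁ v₀‖ * ‖V u₀ v₁‖ : ℝ) : ℂ) * Complex.exp (Complex.I * φ u₁ v₁) *
        e00 - σ * pairing (N u₀ v₀) (U u₀ v₀) (V u₀ v₀) * e11
    have r : A * (Complex.exp (Complex.I * φ u₁ v₀) * Complex.exp (Complex.I * φ u₀ v₁)) =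
        σ ^ 2 * (pairing (N u₁ v₀) (U u₁ v₀) (V u₁ v₀) *
          pairing (N u₀ v₁) (U u₀ v₁) (V u₀ v₁)) := by
      have hA' : A = ((‖U u₁ v₀‖ * ‖V u₀ v₀‖ : ℝ) : ℂ) * ((‖U u₀ v₀‖ * ‖V u₀ v₁‖ : ℝ) : ℂ) := by
        rw [hA]; push_cast; ring
      rw [hA']
      linear_combination ((‖U u₀ v₀‖ * ‖V u₀ v₁‖ : ℝ) : ℂ) * Complex.exp (Complex.I * φ u₀ v₁) *
        e10 - σ * pairing (N u₁ v₀) (U u₁ v₀) (V u₁ v₀) * e01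
    rw [l, hol]
    linear_combination (-Complex.exp (Complex.I * (-K : ℝ))) * r
  have key' := mul_left_cancel₀ hA0 key
  rw [← Complex.exp_add, ← Complex.exp_add, ← Complex.exp_add] at key'
  rw [show Complex.I * ((φ u₀ v₀ + φ u₁ v₁ - φ u₁ v₀ - φ u₀ v₁ + K : ℝ) : ℂ) =
    (Complex.I * φ u₀ v₀ + Complex.I * φ u₁ v₁) - (Complex.I * (-K : ℝ) +
      (Complex.I * φ u₁ v₀ + Complex.I * φ u₀ v₁)) by push_cast; ring, Complex.exp_sub, key',
    div_self (Complex.exp_ne_zero _)]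

lemma continuousOn_jacobian (h : SphericalNet a b N U V ν) :
    ContinuousOn (fun p : ℝ × ℝ => jacobian N U V p.1 p.2) (Icc 0 a ×ˢ Icc 0 b) := by
  have h1 := h.net.cont
  have h2 := h.net.cont_u
  have h3 := h.net.cont_v
  simp only [jacobian, inner_coord, cross_zero, cross_one, cross_two]
  fun_prop

lemma exists_jacobian_bound (h : SphericalNet a b N U V ν) :
    ∃ M, 0 < M ∧ ∀ u ∈ Icc 0 a, ∀ v ∈ Icc 0 b, |jacobian N U V u v| ≤ M := by
  obtain ⟨M, hM⟩ := (isCompact_Icc.prod isCompact_Icc).exists_bound_of_continuousOn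
    h.continuousOn_jacobian
  exact ⟨max M 1, by positivity, fun u hu v hv => (hM (u, v) ⟨hu, hv⟩).trans (le_max_left _ _)⟩

/-- **Hazzidakis' formula** in low regularity. -/
theorem hazzidakis (h : SphericalNet a b N U V ν) (hφ : IsAngle a b N U V σ φ) {u₀ u₁ v₀ v₁ : ℝ}
    (hu0 : 0 ≤ u₀) (hu : u₀ ≤ u₁) (hu1 : u₁ ≤ a) (hv0 : 0 ≤ v₀) (hv : v₀ ≤ v₁) (hv1 : v₁ ≤ b) :
    φ u₀ v₀ + φ u₁ v₁ - φ u₁ v₀ - φ u₀ v₁ =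
      -∫ u in u₀..u₁, ∫ v in v₀..v₁, jacobian N U V u v := by
  obtain ⟨M, hM0, hM⟩ := h.exists_jacobian_bound
  have hJ := h.continuousOn_jacobian
  have hK : IsCompact (Icc 0 a ×ˢ Icc 0 b) := isCompact_Icc.prod isCompact_Icc
  have huN := hK.uniformContinuousOn_of_continuous h.net.cont
  have huφ := hK.uniformContinuousOn_of_continuous hφ.cont
  obtain ⟨δ₁, hδ₁, h1⟩ := Metric.uniformContinuousOn_iff.1 huN 1 one_pos
  obtain ⟨δ₂, hδ₂, h2⟩ := Metric.uniformContinuousOn_iff.1 huφ 1 one_pos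
  -- Below `δ₁` the third coordinate of `N` varies by less than one, so the image avoids one of the
  -- poles. Below `δ₂` the two differences of `φ` are less than one each, and the last two bounds
  -- keep the integral at most one. The total is less than `3 < 2π`.
  obtain ⟨δ, hδ, hδ1, hδ2, hδM, hδl⟩ : ∃ δ > 0, δ < δ₁ ∧ δ < δ₂ ∧ M * δ ≤ 1 ∧ δ ≤ 1 := by
    refine ⟨min (min (δ₁ / 2) (δ₂ / 2)) (min M⁻¹ 1), by positivity, ?_, ?_, ?_, ?_⟩
    · exact ((min_le_left _ _).trans (min_le_left _ _)).trans_lt (by linarith)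
    · exact ((min_le_left _ _).trans (min_le_right _ _)).trans_lt (by linarith)
    · calc M * _ ≤ M * M⁻¹ := by
            gcongr; exact (min_le_right _ _).trans (min_le_left _ _)
        _ = 1 := mul_inv_cancel₀ hM0.ne'
    · exact (min_le_right _ _).trans (min_le_right _ _)
  set G : ℝ → ℝ → ℝ → ℝ → ℝ := fun u₀ u₁ v₀ v₁ => φ u₀ v₀ + φ u₁ v₁ - φ u₁ v₀ - φ u₀ v₁ +
    ∫ u in u₀..u₁, ∫ v in v₀..v₁, jacobian N U V u v with hG
  have small : ∀ u₀ u₁ v₀ v₁, 0 ≤ u₀ → u₀ ≤ u₁ → u₁ ≤ a → u₁ - u₀ ≤ δ → 0 ≤ v₀ → v₀ ≤ v₁ →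
      v₁ ≤ b → v₁ - v₀ ≤ δ → G u₀ u₁ v₀ v₁ = 0 := by
    intro u₀ u₁ v₀ v₁ hu0 hu hu1 hud hv0 hv hv1 hvd
    have mu0 : u₀ ∈ Icc 0 a := ⟨hu0, hu.trans hu1⟩
    have mu1 : u₁ ∈ Icc 0 a := ⟨hu0.trans hu, hu1⟩
    have mv0 : v₀ ∈ Icc 0 b := ⟨hv0, hv.trans hv1⟩
    have mv1 : v₁ ∈ Icc 0 b := ⟨hv0.trans hv, hv1⟩
    have hdist : ∀ u ∈ Icc u₀ u₁, ∀ v ∈ Icc v₀ v₁, dist (u, v) (u₀, v₀) ≤ δ := by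
      intro u hu v hv
      rw [Prod.dist_eq, Real.dist_eq, Real.dist_eq, abs_of_nonneg (by linarith [hu.1]),
        abs_of_nonneg (by linarith [hv.1])]
      exact max_le (by linarith [hu.2]) (by linarith [hv.2])
    have hpole : (∀ u ∈ Icc u₀ u₁, ∀ v ∈ Icc v₀ v₁, -1 < N u v 2) ∨
        ∀ u ∈ Icc u₀ u₁, ∀ v ∈ Icc v₀ v₁, N u v 2 < 1 := by
      have hN : ∀ u ∈ Icc u₀ u₁, ∀ v ∈ Icc v₀ v₁, |N u v 2 - N u₀ v₀ 2| < 1 := by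
        intro u hu v hv
        have := h1 (u, v) ⟨Icc_subset_Icc hu0 hu1 hu, Icc_subset_Icc hv0 hv1 hv⟩ (u₀, v₀)
          ⟨mu0, mv0⟩ ((hdist u hu v hv).trans_lt hδ1)
        rw [dist_eq_norm] at this
        exact (PiLp.norm_apply_le (N u v - N u₀ v₀) 2).trans_lt this
      rcases le_total 0 (N u₀ v₀ 2) with h0 | h0
      · left
        intro u hu v hv
        linarith [(abs_lt.1 (hN u hu v hv)).1]
      · right
        intro u hu v hv
        linarith [(abs_lt.1 (hN u hu v hv)).2]
    refine eq_zero_of_exp_eq_one (h.exp_defect hφ hu0 hu hu1 hv0 hv hv1 hpole) ?_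
    have b1 := h2 (u₀, v₀) ⟨mu0, mv0⟩ (u₁, v₀) ⟨mu1, mv0⟩ (by
      rw [dist_comm]
      exact (hdist u₁ (right_mem_Icc.2 hu) v₀ (left_mem_Icc.2 hv)).trans_lt hδ2)
    have b2 := h2 (u₁, v₁) ⟨mu1, mv1⟩ (u₀, v₁) ⟨mu0, mv1⟩ (by
      rw [Prod.dist_eq, Real.dist_eq, Real.dist_eq, abs_of_nonneg (by linarith), sub_self, abs_zero]
      exact (max_le (by linarith) hδ.le).trans_lt hδ2)
    rw [Real.dist_eq] at b1 b2
    have b3 := abs_integral_le (f := jacobian N U V) (M := M) hu hv fun u hu v hv =>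
      hM u (Icc_subset_Icc hu0 hu1 hu) v (Icc_subset_Icc hv0 hv1 hv)
    have b4 : M * (v₁ - v₀) * (u₁ - u₀) ≤ 1 := by
      calc M * (v₁ - v₀) * (u₁ - u₀) ≤ M * δ * 1 := by
            gcongr
            · linarith
        _ ≤ 1 := by linarith
    have hpi := Real.pi_gt_three
    rw [abs_lt] at b1 b2 ⊢
    have b5 := abs_le.1 (b3.trans b4)
    constructor <;> linarith [b1.1, b1.2, b2.1, b2.2, b5.1, b5.2]
  have all : G u₀ u₁ v₀ v₁ = 0 := by
    -- Additivity in `v`, then in `u`, reduces an arbitrary rectangle to small ones.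
    refine additive_eq_zero (G := fun v₀ v₁ => G u₀ u₁ v₀ v₁) hδ ?_ ?_ v₀ v₁ hv0 hv hv1
    · intro r s t hr hrs hst htb
      simp only [hG, integral_add_right hJ hr hrs hst htb hu0 hu hu1]
      ring
    · intro v₀ v₁ hv0 hv hv1 hvd
      refine additive_eq_zero (G := fun u₀ u₁ => G u₀ u₁ v₀ v₁) hδ ?_ ?_ u₀ u₁ hu0 hu hu1
      · intro r s t hr hrs hst hta
        simp only [hG, integral_add_left hJ hr hrs hst hta hv0 hv hv1]
        ring
      · intro u₀ u₁ hu0 hu hu1 hud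
        exact small u₀ u₁ v₀ v₁ hu0 hu hu1 hud hv0 hv hv1 hvd
  simp only [hG] at all
  linarith

end SphericalNet

/-! ### Angles on adjacent nets, and fronts as nets. -/

section Angle

variable {a b b' σ σ' : ℝ} {N U V N' U' V' : ℝ → ℝ → Space} {ν ν' φ φ' : ℝ → ℝ → ℝ}

/-- Exchanging the coordinates conjugates the pairing and reverses the orientation; `e^{i(π-φ)} =
-e^{-iφ}` accounts for both. This lets statements about `u`-curves serve for `v`-curves. -/
lemma IsAngle.swap (h : IsAngle a b N U V σ φ) :
    IsAngle b a (fun v u => N u v) (fun v u => V u v) (fun v u => U u v) (-σ)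
      (fun v u => Real.pi - φ u v) where
  sign_sq := by rw [neg_sq, h.sign_sq]
  ne_u v hv u hu := h.ne_v u hu v hv
  ne_v v hv u hu := h.ne_u u hu v hv
  mem v hv u hu := ⟨by linarith [(h.mem u hu v hv).2], by linarith [(h.mem u hu v hv).1]⟩
  cont := continuousOn_const.sub
    (h.cont.comp continuous_swap.continuousOn fun _ hp => ⟨hp.2, hp.1⟩)
  exp_eq v hv u hu := by
    have e := congrArg (starRingEnd ℂ) (h.exp_eq u hu v hv)
    simp only [map_mul, map_neg, Complex.conj_ofReal, ← Complex.exp_conj, Complex.conj_I,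
      conj_pairing] at e
    rw [show Complex.I * ((Real.pi - φ u v : ℝ) : ℂ) = Real.pi * Complex.I + -Complex.I * φ u v by
      push_cast; ring, Complex.exp_add, Complex.exp_pi_mul_I]
    push_cast at e ⊢
    linear_combination -e

/-- Dividing one angle relation by the other eliminates the common `U` and leaves the phase between
the two transversal fields. -/
lemma IsAngle.exp_sub (h : SphericalNet a b N U V ν) (hφ : IsAngle a b N U V σ φ)
    (h' : SphericalNet a b' N' U' V' ν') (hφ' : IsAngle a b' N' U' V' σ' φ')
    (hN : ∀ u ∈ Icc 0 a, N' u 0 = N u 0) (hU : ∀ u ∈ Icc 0 a, U' u 0 = U u 0)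
    {u : ℝ} (hu : u ∈ Icc 0 a) :
    ((‖V u 0‖ * ‖V' u 0‖ : ℝ) : ℂ) * Complex.exp (Complex.I * (φ u 0 - φ' u 0 : ℝ)) =
      σ * σ' * pairing (N u 0) (V' u 0) (V u 0) := by
  have m0 : (0 : ℝ) ∈ Icc 0 b := left_mem_Icc.2 h.pos_v.le
  have m0' : (0 : ℝ) ∈ Icc 0 b' := left_mem_Icc.2 h'.pos_v.le
  have e1 := hφ.exp_eq u hu 0 m0
  have e2 := congrArg (starRingEnd ℂ) (hφ'.exp_eq u hu 0 m0')
  simp only [map_mul, map_neg, Complex.conj_ofReal, ← Complex.exp_conj, Complex.conj_I,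
    conj_pairing] at e2
  rw [hN u hu, hU u hu] at e2
  have hp := pairing_mul_pairing (h.unit u hu 0 m0) (h.orth_u hu m0) (h.orth_v hu m0)
    (Z := V' u 0)
  have hne : ((‖U u 0‖ ^ 2 : ℝ) : ℂ) ≠ 0 := by
    exact_mod_cast pow_ne_zero 2 (norm_ne_zero_iff.2 (hφ.ne_u u hu 0 m0))
  apply mul_left_cancel₀ hne
  rw [show Complex.I * ((φ u 0 - φ' u 0 : ℝ) : ℂ) = Complex.I * φ u 0 + -Complex.I * φ' u 0 by
    push_cast; ring, Complex.exp_add]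
  push_cast at e1 e2 hp ⊢
  linear_combination (‖U u 0‖ * ‖V' u 0‖ * Complex.exp (-Complex.I * φ' u 0) : ℂ) * e1 -
    (σ * pairing (N u 0) (U u 0) (V u 0)) * e2 + σ * σ' * hp

/-- Along a common `u`-curve of two nets, the difference of the two asymptotic angles is
constant. -/
lemma IsAngle.sub_eq (h : SphericalNet a b N U V ν) (hφ : IsAngle a b N U V σ φ)
    (h' : SphericalNet a b' N' U' V' ν') (hφ' : IsAngle a b' N' U' V' σ' φ')
    (hN : ∀ u ∈ Icc 0 a, N' u 0 = N u 0) (hU : ∀ u ∈ Icc 0 a, U' u 0 = U u 0)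
    {u : ℝ} (hu : u ∈ Icc 0 a) : φ u 0 - φ' u 0 = φ 0 0 - φ' 0 0 := by
  have m0 : (0 : ℝ) ∈ Icc 0 b := left_mem_Icc.2 h.pos_v.le
  have m0' : (0 : ℝ) ∈ Icc 0 b' := left_mem_Icc.2 h'.pos_v.le
  have ma : (0 : ℝ) ∈ Icc 0 a := left_mem_Icc.2 h.pos_u.le
  have e1 := IsAngle.exp_sub h hφ h' hφ' hN hU hu
  have e2 := IsAngle.exp_sub h hφ h' hφ' hN hU ma
  have hP := h.isParallel_v m0
  -- Only `N` along the shared curve matters, so `V'` is parallel along the same spherical curve as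
  -- `V`.
  have hP' : IsParallel a (fun u => N u 0) (fun u => U u 0) (fun u => V' u 0)
      (fun u => ν' u 0) :=
    { hP with
      orth := fun t ht => by rw [← hN t ht]; exact h'.orth_v ht m0'
      deriv := fun t ht => by rw [← hN t ht]; exact (h'.isParallel_v m0').deriv t ht }
  rw [hP'.pairing_eq hP hu, hP.norm_eq hu, hP'.norm_eq hu, ← e2] at e1
  have hne : ((‖V 0 0‖ * ‖V' 0 0‖ : ℝ) : ℂ) ≠ 0 := by
    exact_mod_cast mul_ne_zero (norm_ne_zero_iff.2 (hφ.ne_v 0 ma 0 m0))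
      (norm_ne_zero_iff.2 (hφ'.ne_v 0 ma 0 m0'))
  have e3 := mul_left_cancel₀ hne e1
  -- Both differences lie in `(-π,π)`, so they are equal once they agree modulo `2π`.
  have e4 : φ u 0 - φ' u 0 - (φ 0 0 - φ' 0 0) = 0 := by
    refine eq_zero_of_exp_eq_one ?_ ?_
    · rw [Complex.ofReal_sub, mul_sub, Complex.exp_sub, e3, div_self (Complex.exp_ne_zero _)]
    · have i1 := hφ.mem u hu 0 m0
      have i2 := hφ.mem 0 ma 0 m0
      have i3 := hφ'.mem u hu 0 m0'
      have i4 := hφ'.mem 0 ma 0 m0'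
      rw [abs_lt]
      constructor <;> linarith [i1.1, i1.2, i2.1, i2.2, i3.1, i3.2, i4.1, i4.2]
  linarith

section Front

variable {r : ℝ → ℝ → Space}

lemma IsWeaklyHarmonic.exists_sphericalNet (ha : 0 < a) (hb : 0 < b)
    (h : IsWeaklyHarmonic a b N)
    (hc : ContinuousOn (fun p : ℝ × ℝ => N p.1 p.2) (Icc 0 a ×ˢ Icc 0 b)) :
    ∃ ν, SphericalNet a b N (partialU a N) (partialV b N) ν := by
  obtain ⟨ν, hν, hm⟩ := h.moutard
  refine ⟨ν, ha, hb, ?_, h.unit⟩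
  refine ⟨fun u hu v hv => (h.c1m.diff_u u hu v hv).hasDerivWithinAt,
    fun u hu v hv => (h.c1m.diff_v u hu v hv).hasDerivWithinAt, fun u hu v hv => ?_,
    fun u hu v hv => ?_, hc, h.c1m.cont_u, h.c1m.cont_v, hν⟩
  · rw [← hm u hu v hv]
    exact (h.c1m.diff_uv u hu v hv).hasDerivWithinAt
  · rw [← hm u hu v hv, h.c1m.mixed_eq u hu v hv]
    exact (h.c1m.diff_vu u hu v hv).hasDerivWithinAt

lemma pos_of_isPreconnected {X : Type*} [TopologicalSpace X] {s : Set X} (hs : IsPreconnected s)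
    {f : X → ℝ} (hf : ContinuousOn f s) (hne : ∀ x ∈ s, f x ≠ 0) {x y : X} (hx : x ∈ s)
    (hy : y ∈ s) (h : 0 < f x) : 0 < f y := by
  by_contra hc
  push Not at hc
  obtain ⟨z, hz, hz0⟩ := hs.intermediate_value hy hx hf ⟨hc, h.le⟩
  exact hne z hz hz0

lemma inner_cross_self_of_front {n X Y : Space} (hn : ‖n‖ = 1) :
    inner ℝ (cross (cross X n) (-cross Y n)) n = -inner ℝ n (cross X Y) := by
  rw [cross_cross_cross, inner_smul_left, real_inner_self_eq_norm_sq, hn]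
  simp

lemma norm_cross_front {n X Y : Space} (hn : ‖n‖ = 1) :
    ‖cross (cross X n) (-cross Y n)‖ = |inner ℝ n (cross X Y)| := by
  rw [cross_cross_cross, norm_smul, hn, mul_one, norm_neg, Real.norm_eq_abs]

/-- If the Jacobian vanished, `pairing_normSq` would give equality in the Cauchy–Schwarz inequality,
and `r_u`, `r_v` would be proportional. -/
lemma jacobian_ne_zero_of_linearIndependent {n X Y : Space} (hn : ‖n‖ = 1)
    (hX : inner ℝ n X = 0) (hY : inner ℝ n Y = 0)
    (hl : LinearIndependent ℝ ![cross X n, -cross Y n]) : inner ℝ n (cross X Y) ≠ 0 := by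
  intro h0
  have h := pairing_normSq hn hX hY
  rw [h0, zero_pow two_ne_zero, add_zero] at h
  have hx0 : cross X n ≠ 0 := hl.ne_zero 0
  have hy0 : -cross Y n ≠ 0 := hl.ne_zero 1
  have hin : inner ℝ (cross X n) (-cross Y n) = -inner ℝ X Y := by
    rw [inner_neg_right, inner_cross_cross hn hX]
  have h1 : |inner ℝ (cross X n) (-cross Y n) / (‖cross X n‖ * ‖-cross Y n‖)| = 1 := by
    rw [abs_div, div_eq_one_iff_eq (by
      simpa using ⟨hx0, neg_ne_zero.1 hy0⟩), hin, norm_neg, norm_cross_of_orthogonal hn hX,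
      norm_cross_of_orthogonal hn hY, abs_neg]
    exact (sq_eq_sq_iff_abs_eq_abs _ _).1 h
  obtain ⟨_, c, hc, hcY⟩ := (abs_real_inner_div_norm_mul_norm_eq_one_iff _ _).1 h1
  have := (LinearIndependent.pair_iff.1 hl) c (-1) (by rw [hcY]; simp)
  exact hc this.1

/-- On an immersed front whose orientation at the corner is `σ`, the asymptotic angle is an angle
between `N_u` and `N_v` in the sense of `IsAngle`, and the area density is `-σ` times the Jacobian
of `N`. -/
lemma IsPSFront.isAngle (ha : 0 < a) (hb : 0 < b) (h : IsPSFront a b r N)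
    (hc : ContinuousOn (fun p : ℝ × ℝ => N p.1 p.2) (Icc 0 a ×ˢ Icc 0 b))
    (himm : ∀ u ∈ Icc 0 a, ∀ v ∈ Icc 0 b,
      LinearIndependent ℝ ![partialU a r u v, partialV b r u v])
    (hσ : σ = 1 ∨ σ = -1)
    (h0 : 0 < σ * inner ℝ (cross (partialU a r 0 0) (partialV b r 0 0)) (N 0 0)) :
    IsAngle a b N (partialU a N) (partialV b N) σ (asymptoticAngle a b r N) ∧
    ∀ u ∈ Icc 0 a, ∀ v ∈ Icc 0 b, ‖cross (partialU a r u v) (partialV b r u v)‖ =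
      -σ * SphericalNet.jacobian N (partialU a N) (partialV b N) u v := by
  obtain ⟨ν, hn⟩ := h.harmonic.exists_sphericalNet ha hb hc
  have ma : (0 : ℝ) ∈ Icc 0 a := left_mem_Icc.2 ha.le
  have mb : (0 : ℝ) ∈ Icc 0 b := left_mem_Icc.2 hb.le
  set J := SphericalNet.jacobian N (partialU a N) (partialV b N) with hJ
  have hσ2 : σ ^ 2 = 1 := by rcases hσ with rfl | rfl <;> norm_num
  have hσ0 : σ ≠ 0 := fun h => by simp [h] at hσ2
  have hJne : ∀ u ∈ Icc 0 a, ∀ v ∈ Icc 0 b, J u v ≠ 0 := fun u hu v hv => by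
    have hl := himm u hu v hv
    rw [h.lelieuvre_u u hu v hv, h.lelieuvre_v u hu v hv] at hl
    exact jacobian_ne_zero_of_linearIndependent (hn.unit u hu v hv) (hn.orth_u hu hv)
      (hn.orth_v hu hv) hl
  have horient : ∀ u ∈ Icc 0 a, ∀ v ∈ Icc 0 b,
      inner ℝ (cross (partialU a r u v) (partialV b r u v)) (N u v) = -J u v :=
    fun u hu v hv => by
      rw [h.lelieuvre_u u hu v hv, h.lelieuvre_v u hu v hv,
        inner_cross_self_of_front (hn.unit u hu v hv)]
      rfl
  rw [horient 0 ma 0 mb] at h0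
  -- The Jacobian has no zero on the connected rectangle, so its sign at the corner persists.
  have hpos : ∀ u ∈ Icc 0 a, ∀ v ∈ Icc 0 b, 0 < σ * -J u v := fun u hu v hv =>
    pos_of_isPreconnected (f := fun p : ℝ × ℝ => σ * -J p.1 p.2) (x := (0, 0)) (y := (u, v))
      (isPreconnected_Icc.prod isPreconnected_Icc)
      (continuousOn_const.mul hn.continuousOn_jacobian.neg)
      (fun p hp => mul_ne_zero hσ0 (neg_ne_zero.2 (hJne p.1 hp.1 p.2 hp.2))) ⟨ma, mb⟩ ⟨hu, hv⟩ h0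
  have hsign : ∀ u ∈ Icc 0 a, ∀ v ∈ Icc 0 b, orientationSign a b r N u v = σ := fun u hu v hv => by
    have hp := hpos u hu v hv
    rw [orientationSign, horient u hu v hv]
    rcases hσ with rfl | rfl
    · exact Real.sign_of_pos (by linarith)
    · exact Real.sign_of_neg (by linarith)
  have hnu : ∀ u ∈ Icc 0 a, ∀ v ∈ Icc 0 b, ‖partialU a r u v‖ = ‖partialU a N u v‖ :=
    fun u hu v hv => by
      rw [h.lelieuvre_u u hu v hv, norm_cross_of_orthogonal (hn.unit u hu v hv) (hn.orth_u hu hv)]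
  have hnv : ∀ u ∈ Icc 0 a, ∀ v ∈ Icc 0 b, ‖partialV b r u v‖ = ‖partialV b N u v‖ :=
    fun u hu v hv => by
      rw [h.lelieuvre_v u hu v hv, norm_neg,
        norm_cross_of_orthogonal (hn.unit u hu v hv) (hn.orth_v hu hv)]
  have hin : ∀ u ∈ Icc 0 a, ∀ v ∈ Icc 0 b, inner ℝ (partialU a r u v) (partialV b r u v) =
      -inner ℝ (partialU a N u v) (partialV b N u v) := fun u hu v hv => by
    rw [h.lelieuvre_u u hu v hv, h.lelieuvre_v u hu v hv, inner_neg_right,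
      inner_cross_cross (hn.unit u hu v hv) (hn.orth_u hu hv)]
  have hmpos : ∀ u ∈ Icc 0 a, ∀ v ∈ Icc 0 b, 0 < ‖partialU a N u v‖ * ‖partialV b N u v‖ :=
    fun u hu v hv => mul_pos (norm_pos_iff.2 (h.harmonic.regular_u u hu v hv))
      (norm_pos_iff.2 (h.harmonic.regular_v u hu v hv))
  set c : ℝ → ℝ → ℝ := fun u v => σ * (-inner ℝ (partialU a N u v) (partialV b N u v) /
    (‖partialU a N u v‖ * ‖partialV b N u v‖)) with hcdef
  have hφ : ∀ u ∈ Icc 0 a, ∀ v ∈ Icc 0 b, asymptoticAngle a b r N u v = Real.arccos (c u v) :=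
    fun u hu v hv => by
      rw [asymptoticAngle, hsign u hu v hv, hin u hu v hv, hnu u hu v hv, hnv u hu v hv]
  -- The base of the square on the right is positive, so it is `sin φ` itself and not only its
  -- absolute value.
  have hcs : ∀ u ∈ Icc 0 a, ∀ v ∈ Icc 0 b, 1 - c u v ^ 2 =
      (σ * -J u v / (‖partialU a N u v‖ * ‖partialV b N u v‖)) ^ 2 := fun u hu v hv => by
    have hp := pairing_normSq (hn.unit u hu v hv) (hn.orth_u hu hv) (hn.orth_v hu hv)
    have hm := (hmpos u hu v hv).ne'
    change _ + J u v ^ 2 = _ at hp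
    simp only [hcdef]
    rw [mul_div_assoc', div_pow, div_pow, eq_div_iff (pow_ne_zero 2 hm), sub_mul,
      div_mul_cancel₀ _ (pow_ne_zero 2 hm)]
    linear_combination -hp - ((inner ℝ (partialU a N u v) (partialV b N u v)) ^ 2 + J u v ^ 2) * hσ2
  have hclt : ∀ u ∈ Icc 0 a, ∀ v ∈ Icc 0 b, |c u v| < 1 := fun u hu v hv => by
    rw [← sq_lt_one_iff_abs_lt_one]
    have : 0 < 1 - c u v ^ 2 := by
      rw [hcs u hu v hv]
      exact pow_pos (div_pos (hpos u hu v hv) (hmpos u hu v hv)) 2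
    linarith
  refine ⟨⟨hσ2, h.harmonic.regular_u, h.harmonic.regular_v, fun u hu v hv => ?_, ?_,
    fun u hu v hv => ?_⟩, fun u hu v hv => ?_⟩
  · rw [hφ u hu v hv]
    have := abs_lt.1 (hclt u hu v hv)
    refine ⟨Real.arccos_pos.2 this.2, lt_of_le_of_ne (Real.arccos_le_pi _) fun he => ?_⟩
    rw [Real.arccos_eq_pi] at he
    linarith
  · have h1 := hn.net.cont_u
    have h2 := hn.net.cont_v
    refine ContinuousOn.congr (f := fun p : ℝ × ℝ => Real.arccos (c p.1 p.2)) ?_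
      (fun p hp => hφ p.1 hp.1 p.2 hp.2)
    exact Real.continuous_arccos.comp_continuousOn (continuousOn_const.mul
      ((SphericalNet.continuousOn_inner h1 h2).neg.div (h1.norm.mul h2.norm)
        fun p hp => (hmpos p.1 hp.1 p.2 hp.2).ne'))
  · have hcl := abs_lt.1 (hclt u hu v hv)
    have hm := (hmpos u hu v hv).ne'
    rw [hφ u hu v hv, mul_comm Complex.I, Complex.exp_mul_I, ← Complex.ofReal_cos,
      ← Complex.ofReal_sin, Real.cos_arccos hcl.1.le hcl.2.le, Real.sin_arccos, hcs u hu v hv,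
      Real.sqrt_sq (div_pos (hpos u hu v hv) (hmpos u hu v hv)).le]
    have e1 : ‖partialU a N u v‖ * ‖partialV b N u v‖ * c u v =
        -σ * inner ℝ (partialU a N u v) (partialV b N u v) := by
      simp only [hcdef]
      rw [mul_left_comm, mul_div_cancel₀ _ hm]; ring
    have e2 : ‖partialU a N u v‖ * ‖partialV b N u v‖ *
        (σ * -J u v / (‖partialU a N u v‖ * ‖partialV b N u v‖)) = -σ * J u v := by
      rw [mul_div_cancel₀ _ hm]; ring
    rw [mul_add, ← mul_assoc, ← Complex.ofReal_mul, ← Complex.ofReal_mul, e1, e2]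
    apply Complex.ext <;> simp [pairing, hJ, SphericalNet.jacobian]
  · rw [h.lelieuvre_u u hu v hv, h.lelieuvre_v u hu v hv, norm_cross_front (hn.unit u hu v hv)]
    change |J u v| = _
    have hp := hpos u hu v hv
    rcases hσ with rfl | rfl
    · rw [abs_of_neg (by linarith)]; ring
    · rw [abs_of_pos (by linarith)]; ring

/-- The asymptotic angle where the asymptotic directions are given by polar angles. -/
lemma asymptoticAngle_of_polar {e₁ e₂ : Space} (he : Orthonormal ℝ ![e₁, e₂])
    {u v c d β γ : ℝ} (hN : cross e₁ e₂ = N u v) (hc : 0 < c) (hd : 0 < d)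
    (hu : partialU a r u v = c • (Real.cos β • e₁ + Real.sin β • e₂))
    (hv : partialV b r u v = d • (Real.cos γ • e₁ + Real.sin γ • e₂)) :
    inner ℝ (cross (partialU a r u v) (partialV b r u v)) (N u v) = c * d * Real.sin (γ - β) ∧
    asymptoticAngle a b r N u v =
      Real.arccos (Real.sign (Real.sin (γ - β)) * Real.cos (γ - β)) := by
  have h1 : inner ℝ e₁ e₁ = (1 : ℝ) := by
    rw [real_inner_self_eq_norm_sq, show ‖e₁‖ = 1 from he.1 0, one_pow]
  have h2 : inner ℝ e₂ e₂ = (1 : ℝ) := by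
    rw [real_inner_self_eq_norm_sq, show ‖e₂‖ = 1 from he.1 1, one_pow]
  have h12 : inner ℝ e₁ e₂ = (0 : ℝ) := he.2 (show (0 : Fin 2) ≠ 1 by decide)
  have key : ∀ x y z w : ℝ, inner ℝ (x • e₁ + y • e₂) (z • e₁ + w • e₂) = x * z + y * w := by
    intro x y z w
    rw [inner_add_left, inner_add_right, inner_add_right]
    simp only [inner_smul_left, inner_smul_right, h1, h2, h12, real_inner_comm e₁ e₂]
    simp
    ring
  have hnorm : ∀ β : ℝ, ‖Real.cos β • e₁ + Real.sin β • e₂‖ = 1 := fun β => by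
    rw [← sq_eq_sq₀ (norm_nonneg _) zero_le_one, ← real_inner_self_eq_norm_sq, key,
      one_pow, ← Real.cos_sq_add_sin_sq β]
    ring
  have horient : inner ℝ (cross (partialU a r u v) (partialV b r u v)) (N u v) =
      c * d * Real.sin (γ - β) := by
    have hG : inner ℝ (cross e₁ e₂) (cross e₁ e₂) = (1 : ℝ) := by
      simp only [inner_coord, cross_zero, cross_one, cross_two] at h1 h2 h12 ⊢
      linear_combination (e₂ 0 * e₂ 0 + e₂ 1 * e₂ 1 + e₂ 2 * e₂ 2) * h1 + h2 -
        (e₁ 0 * e₂ 0 + e₁ 1 * e₂ 1 + e₁ 2 * e₂ 2) * h12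
    have hx : cross (partialU a r u v) (partialV b r u v) =
        (c * d * Real.sin (γ - β)) • cross e₁ e₂ := by
      rw [hu, hv, Real.sin_sub]
      ext i
      fin_cases i <;>
        simp only [cross_zero, cross_one, cross_two, PiLp.add_apply, PiLp.smul_apply,
          smul_eq_mul, Fin.zero_eta, Fin.mk_one, Fin.reduceFinMk] <;> ring
    rw [hx, ← hN, inner_smul_left, hG]
    simp
  refine ⟨horient, ?_⟩
  rw [asymptoticAngle, orientationSign, horient, hu, hv, norm_smul, norm_smul, hnorm, hnorm,
    inner_smul_left, inner_smul_right, key, Real.norm_of_nonneg hc.le, Real.norm_of_nonneg hd.le,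
    Real.cos_sub]
  congr 2
  · rcases lt_trichotomy (Real.sin (γ - β)) 0 with h | h | h
    · rw [Real.sign_of_neg h, Real.sign_of_neg (mul_neg_of_pos_of_neg (mul_pos hc hd) h)]
    · rw [h, mul_zero]
    · rw [Real.sign_of_pos h, Real.sign_of_pos (mul_pos (mul_pos hc hd) h)]
  · simp only [conj_trivial]
    field_simp

end Front

end Angle

/-! ### The sectors and rays of the star. -/

namespace MStar

variable {m : ℕ} {T : MStar m} {r N : Plane → Space}

lemma uRay_even {j : ℕ} (hj : Even j) : uRay j = j := if_pos hj
lemma vRay_even {j : ℕ} (hj : Even j) : vRay j = j + 1 := if_pos hj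
lemma uRay_odd {j : ℕ} (hj : ¬Even j) : uRay j = j + 1 := if_neg hj
lemma vRay_odd {j : ℕ} (hj : ¬Even j) : vRay j = j := if_neg hj

lemma polar_vRay_sub (T : MStar m) (j : ℕ) :
    T.polar (vRay j) - T.polar (uRay j) = if Even j then T.angle j else -T.angle j := by
  have h : T.polar (j + 1) = T.polar j + T.angle j := Finset.sum_range_succ _ _
  split_ifs with hj
  · rw [uRay_even hj, vRay_even hj, h]; ring
  · rw [uRay_odd hj, vRay_odd hj, h]; ring

lemma uLen_pos (T : MStar m) (j : ℕ) : 0 < T.uLen j := T.len_pos _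
lemma vLen_pos (T : MStar m) (j : ℕ) : 0 < T.vLen j := T.len_pos _

lemma continuousOn_pull {f : Plane → Space} (hf : ContinuousOn f T.carrier) (j : ℕ) :
    ContinuousOn (fun p : ℝ × ℝ => T.pull f j p.1 p.2)
      (Icc 0 (T.uLen j) ×ˢ Icc 0 (T.vLen j)) :=
  hf.comp (f := fun p : ℝ × ℝ => T.chart j p.1 p.2) (by unfold chart; fun_prop)
    fun p hp => mem_iUnion.2 ⟨j, p, hp, rfl⟩

lemma partialU_pull_zero (T : MStar m) (r : Plane → Space) (j : ℕ) :
    partialU (T.uLen j) (T.pull r j) 0 0 = T.outgoing r (uRay j) := by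
  simp [partialU, pull, chart, outgoing, uLen]

lemma partialV_pull_zero (T : MStar m) (r : Plane → Space) (j : ℕ) :
    partialV (T.vLen j) (T.pull r j) 0 0 = T.outgoing r (vRay j) := by
  simp [partialV, pull, chart, outgoing, vLen]

namespace IsBranchedFront

/-- The order `(u,v)` is counterclockwise in even sectors and clockwise in odd ones. Since `cos φ`
carries the factor `σ`, the angle at the centre is `α_j` in the first case and `π - α_j` in the
second. -/
lemma orientation_and_angle_zero (h : T.IsBranchedFront r N) (j : ℕ) :
    0 < (-1 : ℝ) ^ j * inner ℝ (cross (partialU (T.uLen j) (T.pull r j) 0 0)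
      (partialV (T.vLen j) (T.pull r j) 0 0)) (T.pull N j 0 0) ∧
    (-1 : ℝ) ^ j * T.phi r N j 0 0 = T.angle j - if Even j then 0 else Real.pi := by
  obtain ⟨e₁, e₂, he, hN, ht⟩ := h.tangent
  obtain ⟨c, hc, hu⟩ := ht (uRay j)
  obtain ⟨d, hd, hv⟩ := ht (vRay j)
  rw [← partialU_pull_zero] at hu
  rw [← partialV_pull_zero] at hv
  have hN' : cross e₁ e₂ = T.pull N j 0 0 := by simp [hN, pull, chart]
  obtain ⟨h1, h2⟩ := asymptoticAngle_of_polar he hN' hc hd hu hv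
  have hs : 0 < Real.sin (T.angle j) := Real.sin_pos_of_pos_of_lt_pi (T.angle_pos j) (T.angle_lt j)
  rw [h1, phi, h2, polar_vRay_sub]
  split_ifs with hj
  · rw [hj.neg_one_pow, Real.sign_of_pos hs, one_mul, one_mul, one_mul,
      Real.arccos_cos (T.angle_pos j).le (T.angle_lt j).le]
    exact ⟨by positivity, by ring⟩
  · rw [(Nat.not_even_iff_odd.1 hj).neg_one_pow, Real.sin_neg, Real.cos_neg,
      Real.sign_of_neg (neg_neg_of_pos hs), neg_one_mul (Real.cos _), Real.arccos_neg,
      Real.arccos_cos (T.angle_pos j).le (T.angle_lt j).le]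
    refine ⟨?_, by ring⟩
    rw [mul_neg, neg_mul_neg, one_mul]
    positivity

lemma isAngle (h : T.IsBranchedFront r N) (j : ℕ) :
    IsAngle (T.uLen j) (T.vLen j) (T.pull N j) (partialU (T.uLen j) (T.pull N j))
      (partialV (T.vLen j) (T.pull N j)) ((-1) ^ j) (T.phi r N j) ∧
    ∀ u ∈ Icc 0 (T.uLen j), ∀ v ∈ Icc 0 (T.vLen j),
      ‖cross (partialU (T.uLen j) (T.pull r j) u v) (partialV (T.vLen j) (T.pull r j) u v)‖ =
      -(-1) ^ j * SphericalNet.jacobian (T.pull N j) (partialU (T.uLen j) (T.pull N j))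
        (partialV (T.vLen j) (T.pull N j)) u v :=
  (h.psFront j).isAngle (T.uLen_pos j) (T.vLen_pos j) (continuousOn_pull h.continuousOn_normal j)
    (h.immersed j) (neg_one_pow_eq_or ℝ j) (h.orientation_and_angle_zero j).1

lemma exists_sphericalNet (h : T.IsBranchedFront r N) (j : ℕ) :
    ∃ ν, SphericalNet (T.uLen j) (T.vLen j) (T.pull N j) (partialU (T.uLen j) (T.pull N j))
      (partialV (T.vLen j) (T.pull N j)) ν :=
  (h.psFront j).harmonic.exists_sphericalNet (T.uLen_pos j) (T.vLen_pos j)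
    (continuousOn_pull h.continuousOn_normal j)

/-- Hazzidakis' formula on a whole sector. -/
lemma sector_defect (h : T.IsBranchedFront r N) (j : ℕ) :
    T.phiRay r N j 0 0 + T.phiRay r N j (T.len j) (T.len (j + 1)) - T.phiRay r N j (T.len j) 0 -
      T.phiRay r N j 0 (T.len (j + 1)) =
        (-1 : ℝ) ^ j * quadArea (T.uLen j) (T.vLen j) (T.pull r j) := by
  obtain ⟨ν, hn⟩ := h.exists_sphericalNet j
  obtain ⟨hφ, hA⟩ := h.isAngle j
  have hz := hn.hazzidakis hφ le_rfl (T.uLen_pos j).le le_rfl le_rfl (T.vLen_pos j).le le_rfl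
  rw [quadArea, integral_integral_congr (T.uLen_pos j).le (T.vLen_pos j).le hA]
  simp only [intervalIntegral.integral_const_mul]
  rw [← mul_assoc, mul_neg, ← mul_pow, neg_one_mul, neg_neg, one_pow, neg_one_mul, ← hz]
  by_cases hj : Even j
  · simp only [phiRay, if_pos hj, uLen, vLen, uRay_even hj, vRay_even hj]
  · simp only [phiRay, if_neg hj, uLen, vLen, uRay_odd hj, vRay_odd hj]
    ring

lemma exists_defect_bound (h : T.IsBranchedFront r N) (j : ℕ) :
    ∃ M, 0 < M ∧ ∀ c₀ c₁ d₀ d₁, 0 ≤ c₀ → c₀ ≤ c₁ → c₁ ≤ T.len j → 0 ≤ d₀ → d₀ ≤ d₁ →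
      d₁ ≤ T.len (j + 1) → |T.phiRay r N j c₀ d₀ + T.phiRay r N j c₁ d₁ - T.phiRay r N j c₁ d₀ -
        T.phiRay r N j c₀ d₁| ≤ M * (d₁ - d₀) * (c₁ - c₀) := by
  obtain ⟨ν, hn⟩ := h.exists_sphericalNet j
  obtain ⟨hφ, -⟩ := h.isAngle j
  obtain ⟨M, hM0, hM⟩ := hn.exists_jacobian_bound
  refine ⟨M, hM0, fun c₀ c₁ d₀ d₁ hc0 hc hc1 hd0 hd hd1 => ?_⟩
  have key : ∀ u₀ u₁ v₀ v₁, 0 ≤ u₀ → u₀ ≤ u₁ → u₁ ≤ T.uLen j → 0 ≤ v₀ → v₀ ≤ v₁ →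
      v₁ ≤ T.vLen j → |T.phi r N j u₀ v₀ + T.phi r N j u₁ v₁ - T.phi r N j u₁ v₀ -
        T.phi r N j u₀ v₁| ≤ M * (v₁ - v₀) * (u₁ - u₀) := by
    intro u₀ u₁ v₀ v₁ hu0 hu hu1 hv0 hv hv1
    rw [hn.hazzidakis hφ hu0 hu hu1 hv0 hv hv1, abs_neg]
    exact abs_integral_le hu hv fun u hu v hv =>
      hM u (Icc_subset_Icc hu0 hu1 hu) v (Icc_subset_Icc hv0 hv1 hv)
  by_cases hj : Even j
  · simp only [phiRay, if_pos hj]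
    exact key c₀ c₁ d₀ d₁ hc0 hc (by rwa [uLen, uRay_even hj]) hd0 hd
      (by rwa [vLen, vRay_even hj])
  · simp only [phiRay, if_neg hj]
    have := key d₀ d₁ c₀ c₁ hd0 hd (by rwa [uLen, uRay_odd hj]) hc0 hc
      (by rwa [vLen, vRay_odd hj])
    rw [sub_right_comm]
    linarith

/-- The difference of the two values of `φ` along a ray is constant. -/
lemma phiRay_sub_eq (h : T.IsBranchedFront r N) (j : ℕ) {t : ℝ} (ht : t ∈ Icc 0 (T.len (j + 1))) :
    T.phiRay r N j 0 t - T.phiRay r N (j + 1) t 0 =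
      T.phiRay r N j 0 0 - T.phiRay r N (j + 1) 0 0 := by
  obtain ⟨ν, hn⟩ := h.exists_sphericalNet j
  obtain ⟨ν', hn'⟩ := h.exists_sphericalNet (j + 1)
  have hφ := (h.isAngle j).1
  have hφ' := (h.isAngle (j + 1)).1
  by_cases hj : Even j
  · have hj' : ¬Even (j + 1) := by rwa [Nat.even_add_one, not_not]
    have e1 : T.vLen j = T.len (j + 1) := by rw [vLen, vRay_even hj]
    have e2 : T.vLen (j + 1) = T.len (j + 1) := by rw [vLen, vRay_odd hj']
    have hN : ∀ v, T.pull N (j + 1) 0 v = T.pull N j 0 v := fun v => by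
      simp [pull, chart, vRay_even hj, vRay_odd hj']
    rw [e1] at hn hφ
    rw [e2] at hn' hφ'
    -- The common ray is a `v`-curve here; after the swap, `π` drops out of the differences.
    have := IsAngle.sub_eq hn.swap hφ.swap hn'.swap hφ'.swap (fun v _ => hN v)
      (fun v _ => by simp only [partialV, hN]) ht
    simp only [phiRay, if_pos hj, if_neg hj']
    linarith
  · have hj' : Even (j + 1) := by rwa [Nat.even_add_one]
    have e1 : T.uLen j = T.len (j + 1) := by rw [uLen, uRay_odd hj]
    have e2 : T.uLen (j + 1) = T.len (j + 1) := by rw [uLen, uRay_even hj']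
    have hN : ∀ u, T.pull N (j + 1) u 0 = T.pull N j u 0 := fun v => by
      simp [pull, chart, uRay_odd hj, uRay_even hj']
    rw [e1] at hn hφ
    rw [e2] at hn' hφ'
    simp only [phiRay, if_neg hj, if_pos hj']
    exact IsAngle.sub_eq hn hφ hn' hφ' (fun u _ => hN u)
      (fun u _ => by simp only [partialU, hN]) ht

end IsBranchedFront

/-! ### Periodicity -/

lemma even_add_period (m j : ℕ) : Even (j + 2 * m) ↔ Even j := by
  simp [Nat.even_add]

lemma ray_add_period (T : MStar m) (j : ℕ) : T.ray (j + 2 * m) = T.ray j := by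
  have h : T.polar (j + 2 * m) = T.polar j + 2 * Real.pi := by
    rw [polar, add_comm j, Finset.sum_range_add, T.angle_sum, polar, add_comm]
    congr 1
    refine Finset.sum_congr rfl fun k _ => ?_
    rw [add_comm]
    exact T.angle_periodic k
  rw [ray, ray, h, Real.cos_add_two_pi, Real.sin_add_two_pi]

lemma uRay_add_period (m j : ℕ) : uRay (j + 2 * m) = uRay j + 2 * m := by
  simp only [uRay, even_add_period]
  split_ifs <;> omega

lemma vRay_add_period (m j : ℕ) : vRay (j + 2 * m) = vRay j + 2 * m := by
  simp only [vRay, even_add_period]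
  split_ifs <;> omega

lemma phiRay_add_period (T : MStar m) (r N : Plane → Space) (j : ℕ) :
    T.phiRay r N (j + 2 * m) = T.phiRay r N j := by
  have hchart : T.chart (j + 2 * m) = T.chart j := by
    funext u v
    rw [chart, chart, uRay_add_period, vRay_add_period, ray_add_period, ray_add_period]
  have hu : T.uLen (j + 2 * m) = T.uLen j := by
    rw [uLen, uLen, uRay_add_period]; exact T.len_periodic _
  have hv : T.vLen (j + 2 * m) = T.vLen j := by
    rw [vLen, vLen, vRay_add_period]; exact T.len_periodic _
  have hpull : ∀ f, T.pull f (j + 2 * m) = T.pull f j := fun f => by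
    funext u v
    rw [pull, pull, hchart]
  funext c d
  simp only [phiRay, phi, hpull, hu, hv, even_add_period]

lemma stripSum_periodic (T : MStar m) (r N : Plane → Space) (t₀ t₁ ε : ℝ) :
    Function.Periodic (fun j => T.stripSum r N j t₀ t₁ ε) (2 * m) := by
  intro j
  simp only [stripSum]
  rw [add_right_comm j (2 * m) 1, phiRay_add_period, phiRay_add_period, pow_add _ (j + 1), pow_mul]
  simp

lemma sum_odd_indicator (m : ℕ) (x : ℝ) :
    ∑ j ∈ Finset.range (2 * m), (if Even j then 0 else x) = m * x := by
  induction m with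
  | zero => simp
  | succ m ih =>
    rw [mul_add, mul_one, Finset.sum_range_succ, Finset.sum_range_succ, ih]
    simp
    ring

/-! ### Summation around the star and the strip estimate. -/

namespace IsBranchedFront

lemma vertexSum_eq (h : T.IsBranchedFront r N) :
    T.vertexSum r N = T.area r - ((m : ℝ) - 2) * Real.pi := by
  set f : ℕ → ℝ := fun j => (-1) ^ j * T.phiRay r N j (T.len j) 0 with hf
  set z : ℕ → ℝ := fun j => (-1) ^ j * T.phiRay r N j 0 0 with hz
  have hcorner : ∀ j, T.phi r N j (T.uLen j) (T.vLen j) =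
      T.phiRay r N j (T.len j) (T.len (j + 1)) := fun j => by
    by_cases hj : Even j
    · simp only [phiRay, if_pos hj, uLen, vLen, uRay_even hj, vRay_even hj]
    · simp only [phiRay, if_neg hj, uLen, vLen, uRay_odd hj, vRay_odd hj]
  -- `sector_defect` expresses the corner value, and `phiRay_sub_eq` moves the value at the end of
  -- the ray `j+1` into the next sector. This leaves `f j - f (j+1) + z (j+1)`, written so that two
  -- differences telescope.
  have hstep : ∀ j, (-1 : ℝ) ^ j * T.phi r N j (T.uLen j) (T.vLen j) =
      quadArea (T.uLen j) (T.vLen j) (T.pull r j) - (f (j + 1) - f j) +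
        ((z (j + 1) - z j) + z j) := fun j => by
    have hs : ((-1 : ℝ) ^ j) * (-1) ^ j = 1 := by rw [← mul_pow]; simp
    have h1 := h.sector_defect j
    have h2 := h.phiRay_sub_eq j (right_mem_Icc.2 (T.len_pos (j + 1)).le)
    rw [hcorner]
    simp only [hf, hz, pow_succ]
    linear_combination (-1 : ℝ) ^ j * h1 + (-1) ^ j * h2 +
      quadArea (T.uLen j) (T.vLen j) (T.pull r j) * hs
  -- The number of sectors is even, so the alternating sign returns to its initial value after one
  -- turn.
  have hfp : f (2 * m) = f 0 := by
    have h1 := T.len_periodic 0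
    have h2 := T.phiRay_add_period r N 0
    rw [zero_add] at h1 h2
    simp only [hf, h1, h2, pow_mul]
    simp
  have hzp : z (2 * m) = z 0 := by
    have h2 := T.phiRay_add_period r N 0
    rw [zero_add] at h2
    simp only [hz, h2, pow_mul]
    simp
  have hzval : ∀ j, z j = T.angle j - if Even j then 0 else Real.pi := fun j => by
    rw [← (h.orientation_and_angle_zero j).2]
    simp only [hz, phiRay, ite_self]
  rw [vertexSum, Finset.sum_congr rfl fun j _ => hstep j, Finset.sum_add_distrib,
    Finset.sum_sub_distrib, Finset.sum_add_distrib, Finset.sum_range_sub, Finset.sum_range_sub,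
    hfp, hzp, Finset.sum_congr rfl fun j _ => hzval j, Finset.sum_sub_distrib, T.angle_sum,
    sum_odd_indicator, area]
  ring

/-- Up to sign, the strip sum combines the double differences over the two half-strips; the jumps of
`φ` across the ray at `t₀` and `t₁` are equal and cancel. -/
lemma exists_strip_bound (h : T.IsBranchedFront r N) (j : ℕ) :
    ∃ C, 0 ≤ C ∧ ∀ t₀ t₁ ε : ℝ, 0 ≤ t₀ → t₀ ≤ t₁ → t₁ ≤ T.len (j + 1) →
      0 < ε → ε ≤ T.len j → ε ≤ T.len (j + 2) → |T.stripSum r N j t₀ t₁ ε| ≤ C * ε := by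
  obtain ⟨M, hM0, hM⟩ := h.exists_defect_bound j
  obtain ⟨M', hM0', hM'⟩ := h.exists_defect_bound (j + 1)
  refine ⟨(M + M') * T.len (j + 1), mul_nonneg (by linarith) (T.len_pos _).le, ?_⟩
  intro t₀ t₁ ε h0 h01 h1 hε hεj hεj'
  have b1 := hM 0 ε t₀ t₁ le_rfl hε.le hεj h0 h01 h1
  have b2 := hM' t₀ t₁ 0 ε h0 h01 h1 le_rfl hε.le hεj'
  have s0 := h.phiRay_sub_eq j (t := t₀) ⟨h0, h01.trans h1⟩
  have s1 := h.phiRay_sub_eq j (t := t₁) ⟨h0.trans h01, h1⟩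
  rw [stripSum, abs_mul, abs_pow, abs_neg, abs_one, one_pow, one_mul]
  have b3 : (M + M') * (t₁ - t₀) * ε ≤ (M + M') * T.len (j + 1) * ε := by
    gcongr
    linarith
  rw [abs_le] at b1 b2 ⊢
  constructor <;> linarith [b1.1, b1.2, b2.1, b2.2]

lemma exists_uniform_strip_bound (h : T.IsBranchedFront r N) :
    ∃ C : ℝ, ∀ (j : ℕ) (t₀ t₁ ε : ℝ), 0 ≤ t₀ → t₀ ≤ t₁ → t₁ ≤ T.len (j + 1) →
      0 < ε → ε ≤ T.len j → ε ≤ T.len (j + 2) → |T.stripSum r N j t₀ t₁ ε| ≤ C * ε := by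
  choose C hC0 hC using h.exists_strip_bound
  -- For `m = 0` the angle sum would be empty. Positivity places the residue `j % (2 * m)` in the
  -- range of summation.
  have hm : 0 < 2 * m := by
    rcases Nat.eq_zero_or_pos m with rfl | hm
    · have := T.angle_sum
      simp only [mul_zero, Finset.range_zero, Finset.sum_empty] at this
      linarith [Real.pi_pos]
    · omega
  -- The sum of the nonnegative constants over one period dominates each of them.
  refine ⟨∑ k ∈ Finset.range (2 * m), C k, fun j t₀ t₁ ε h0 h01 h1 hε hεj hεj' => ?_⟩
  have hlen : ∀ k, T.len (j % (2 * m) + k) = T.len (j + k) := fun k => by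
    rw [← T.len_periodic.map_mod_nat (j + k), ← T.len_periodic.map_mod_nat (j % (2 * m) + k),
      Nat.mod_add_mod]
  rw [← (T.stripSum_periodic r N t₀ t₁ ε).map_mod_nat j]
  refine (hC (j % (2 * m)) t₀ t₁ ε h0 h01 (by rwa [hlen]) hε
    (by simpa [hlen 0] using hεj.trans_eq (hlen 0).symm) (by rwa [hlen])).trans ?_
  gcongr
  exact Finset.single_le_sum (fun k _ => hC0 k) (Finset.mem_range.2 (Nat.mod_lt _ hm))

end IsBranchedFront

end MStar

end PSBranch

end

theorem mainTheorem6 (m : ℕ) (T : PSBranch.MStar m) (r N : PSBranch.Plane → PSBranch.Space)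
    (h : T.IsBranchedFront r N) :
    T.vertexSum r N = T.area r - ((m : ℝ) - 2) * Real.pi ∧
    ∃ C : ℝ, ∀ (j : ℕ) (t₀ t₁ ε : ℝ), 0 ≤ t₀ → t₀ ≤ t₁ → t₁ ≤ T.len (j + 1) →
      0 < ε → ε ≤ T.len j → ε ≤ T.len (j + 2) →
      |T.stripSum r N j t₀ t₁ ε| ≤ C * ε :=
  ⟨h.vertexSum_eq, h.exists_uniform_strip_bound⟩
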